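/- Let $G=(V,E)$ be a directed acyclic graph on $V=\{1,\dots,p\}$ and let $\breve x(k)\in\mathbb R^p$, $k\in\mathbb Z$, be the states of a linear dynamical system over $G$, $$\breve x_i(k)=\sum_{j}(\breve h_{ij}\star\breve x_j)(k)+\breve e_i(k),\qquad k\in\mathbb Z,\ 1\le i\le p,$$ where $\breve h_{ij}:\mathbb Z\to\mathbb R$ is a nonzero filter if $(j,i)\in E$ and $\breve h_{ij}=0$ otherwise, the two-sided convolution sums are limits in mean square of their symmetric partial sums, and the noise $\breve e=(\breve e_1,\dots,\breve e_p)$ is a zero-mean wide-sense stationary (jointly) Gaussian process whose coordinates are mutually uncorrelated (their power spectral densities need not be equal). Put $R_x(k)=\mathbb E[\breve x(k)\breve x(0)^T]$ and $\Phi_x(\omega)=\sum_{k\in\mathbb Z}R_x(k)e^{-i\omega k}$, and let $\|\cdot\|$ be the spectral norm. Assume: 1. $\frac1M\le\lambda_{\min}(\Phi_x(\omega))\le\lambda_{\max}(\Phi_x(\omega))\le M$ for all $\omega\in[0,2\pi]$, for a real $M>0$; 2. $\|R_x(k)\|\le C\rho^{-|k|}$ for all $k\in\mathbb Z$, for real constants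 $C>0$, $\rho>1$. Let $\{\breve x^r(k)\}_{k=0}^{N-1}$, $1\le r\le n$, be $n$ recorded trajectories of length $N$, obtained either by restart and record (independent trajectories, each with the law of $(\breve x(0),\dots,\breve x(N-1))$) or by continuous sampling (the $n$ consecutive segments of length $N$ of a single trajectory $\breve x(0),\dots,\breve x(nN-1)$). Put $${\bf x}^r(\omega)=\frac1{\sqrt N}\sum_{k=0}^{N-1}\breve x^r(k)e^{-i\omega k},\qquad \widehat\Phi_x(\omega)=\frac1n\sum_{r=1}^n{\bf x}^r(\omega)[{\bf x}^r(\omega)]^*.$$ Let $0<\varepsilon_1,\varepsilon_2<\varepsilon$ with $\varepsilon_2=\varepsilon-\varepsilon_1$ and $\varepsilon_2\le 12M$, and suppose that $N>\frac{2C\rho^{-1}}{(1-\rho^{-1})^2\varepsilon_1}$. Then for every $\omega\in[0,2\pi]$, $$\mathbb P\left(\|\Phi_x(\omega)-\widehat\Phi_x(\omega)\|\ge\varepsilon\right)\le\exp\left(-\frac{\varepsilon_2^2\,n}{128M^2}+6p\right).$$ -/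

import Mathlib

open MeasureTheory ProbabilityTheory Filter Topology
open scoped Matrix.Norms.L2Operator

namespace DDAG

variable {Ω Ω' : Type*} [MeasurableSpace Ω] [MeasurableSpace Ω'] {p n N : ℕ}

/-- A directed graph without directed cycles (in particular, without self-loops). -/
def IsAcyclic (G : Digraph (Fin p)) : Prop :=
  ∀ i, ¬ Relation.TransGen G.Adj i i

/-- The exogenous noise: a zero-mean, wide-sense stationary (vector-valued, i.e. jointly) Gaussian
process indexed by `ℤ`, whose coordinates are mutually uncorrelated. -/
structure IsExogenousNoise (P : Measure Ω) (e : ℤ → Ω → Fin p → ℝ) : Prop where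
  gaussian : IsGaussianProcess e P
  zero_mean : ∀ k i, ∫ ω, e k ω i ∂P = 0
  stationary : ∀ k l i j,
    ∫ ω, e (k + l) ω i * e l ω j ∂P = ∫ ω, e k ω i * e 0 ω j ∂P
  uncorrelated : ∀ i j, i ≠ j → ∀ k l, ∫ ω, e k ω i * e l ω j ∂P = 0

/-- The linear dynamical system over the directed acyclic graph `G`, with filters
`h i j : ℤ → ℝ` (nonzero exactly on the edges `j → i`), exogenous noise `e` and states `x`:
`x_i(k) = ∑_j (h_ij ⋆ x_j)(k) + e_i(k)` for all times `k : ℤ` and all nodes `i`.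
The two-sided convolution sum `∑_m h_ij(m) x_j(k - m)` is the limit in mean square of its partial
sums over `|m| ≤ K`. -/
structure IsLDS (P : Measure Ω) (G : Digraph (Fin p)) (h : Fin p → Fin p → ℤ → ℝ)
    (e x : ℤ → Ω → Fin p → ℝ) : Prop where
  acyclic : IsAcyclic G
  filter_ne_zero_iff : ∀ i j, h i j ≠ 0 ↔ G.Adj j i
  noise : IsExogenousNoise P e
  measurable_state : ∀ k, Measurable (x k)
  dynamics : ∀ k i, Tendsto
    (fun K : ℕ => eLpNorm
      (fun ω => x k ω i
        - (∑ j, ∑ m ∈ Finset.Icc (-(K : ℤ)) K, h i j m * x (k - m) ω j + e k ω i)) 2 P)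
    atTop (𝓝 0)

/-- The autocorrelation matrix `R_x(k) = E[x(k) x(0)ᵀ]`. -/
noncomputable def autocorr (P : Measure Ω) (x : ℤ → Ω → Fin p → ℝ) (k : ℤ) :
    Matrix (Fin p) (Fin p) ℝ :=
  Matrix.of fun i j => ∫ ω, x k ω i * x 0 ω j ∂P

/-- The power spectral density matrix `Φ_x(θ) = ∑_{k ∈ ℤ} R_x(k) e^{-iθk}`. -/
noncomputable def psdm (P : Measure Ω) (x : ℤ → Ω → Fin p → ℝ) (θ : ℝ) :
    Matrix (Fin p) (Fin p) ℂ :=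
  Matrix.of fun i j =>
    ∑' k : ℤ, (autocorr P x k i j : ℂ) * Complex.exp (-(Complex.I * θ * k))

/-- All eigenvalues of the (Hermitian) matrices `Φ_x(θ)`, `θ ∈ [0, 2π]`, lie in `[1/M, M]`. -/
def PSDMBound (P : Measure Ω) (x : ℤ → Ω → Fin p → ℝ) (M : ℝ) : Prop :=
  0 < M ∧ ∀ θ ∈ Set.Icc 0 (2 * Real.pi), ∀ μ ∈ spectrum ℝ (psdm P x θ), 1 / M ≤ μ ∧ μ ≤ M

/-- Geometric decay `‖R_x(k)‖ ≤ C ρ^{-|k|}` of the autocorrelation in spectral norm. -/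
def AutocorrDecay (P : Measure Ω) (x : ℤ → Ω → Fin p → ℝ) (C ρ : ℝ) : Prop :=
  0 < C ∧ 1 < ρ ∧ ∀ k : ℤ, ‖autocorr P x k‖ ≤ C * ρ ^ (-|k|)

/-- Restart and record: the `n` trajectories `y 0, …, y (n-1)` are independent, and each has the
law of `N` consecutive states `x(0), …, x(N-1)` of the system. -/
structure RestartAndRecord (P : Measure Ω) (x : ℤ → Ω → Fin p → ℝ)
    (P' : Measure Ω') (y : Fin n → Ω' → Fin N → Fin p → ℝ) : Prop where
  indep : iIndepFun y P'
  law : ∀ r, IdentDistrib (y r) (fun ω (t : Fin N) => x (t : ℤ) ω) P' P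

/-- Continuous sampling: the `n` trajectories are the consecutive segments of length `N` of one
trajectory `x(0), …, x(nN-1)` of the system (i.e. they have the joint law of these segments). -/
def ContinuousSampling (P : Measure Ω) (x : ℤ → Ω → Fin p → ℝ)
    (P' : Measure Ω') (y : Fin n → Ω' → Fin N → Fin p → ℝ) : Prop :=
  IdentDistrib (fun ω' (r : Fin n) => y r ω')
    (fun ω (r : Fin n) (t : Fin N) => x ((r : ℤ) * N + t) ω) P' P

/-- The normalized finite Fourier transform `N^{-1/2} ∑_{k=0}^{N-1} y(k) e^{-iθk}` of a recorded
trajectory. -/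
noncomputable def dft (y : Fin N → Fin p → ℝ) (θ : ℝ) : Fin p → ℂ :=
  fun i => (1 / (Real.sqrt N : ℂ)) *
    ∑ k : Fin N, (y k i : ℂ) * Complex.exp (-(Complex.I * θ * ((k : ℕ) : ℂ)))

/-- The spectrogram estimator `(1/n) ∑_r x^r(θ) [x^r(θ)]^*` built from `n` trajectories. -/
noncomputable def psdmEstimator (y : Fin n → Fin N → Fin p → ℝ) (θ : ℝ) :
    Matrix (Fin p) (Fin p) ℂ :=
  (1 / (n : ℂ)) • ∑ r, Matrix.vecMulVec (dft (y r) θ) (star (dft (y r) θ))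

end DDAG

/-! The error splits into a bias and a fluctuation around the mean `meanPsdm` of the estimator. That
mean is a Cesàro average of partial sums of the series for Φ_x, so geometric decay of the
autocorrelation makes the bias smaller than ε₁ (`AutocorrDecay.bias`). The bad event therefore
forces a Hermitian fluctuation of norm at least ε₂. A 1/2-net of the unit sphere of ℂ^p with at most
25^p points (`exists_net`) detects it: at some net point the quadratic form is at least half the
norm (`exists_norm_le_two_mul_quadratic`). A union bound over the net costs the factor e^{6p}.

For a fixed unit vector v, n times the quadratic form of the estimator at v is the squared length of
a centred Gaussian vector in ℝ^{2n}. Its concentration (`measure_abs_sum_sq_sub_ge_le`) needs only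
bounds on the operator norm and the trace of the covariance. The covariance of distinct samples of x
is a section of a block Toeplitz operator with symbol Φ_x ≤ M, hence at most M (`autocorr_form_le`).
Correlation between consecutive segments is thus harmless, and independent trajectories satisfy the
same bound because variances add; both sampling schemes reduce to `IsGaussianSample`.

Gaussianity and stationarity of the states are derived, not assumed: induction along the acyclic
graph places them in the closed L² span of the shifted noise (`IsLDS.inShiftSpan`). -/

namespace DDAG

/-! ### Concentration of the squared length of a Gaussian vector. -/

lemma inv_one_sub_le_exp {w : ℝ} (hw : |w| ≤ 1 / 2) : (1 - w)⁻¹ ≤ Real.exp (w + w ^ 2) := by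
  obtain ⟨h1, h2⟩ := abs_le.1 hw
  rw [inv_le_iff_one_le_mul₀ (by linarith)]
  -- The linear bound on exp gives (1 + w + w²)(1 - w) = 1 - w³, which suffices only for w ≤ 0;
  -- positive w needs the quadratic term as well.
  rcases le_total 0 w with h | h
  · have := Real.quadratic_le_exp_of_nonneg (x := w + w ^ 2) (by positivity)
    refine le_trans ?_ (mul_le_mul_of_nonneg_right this (by linarith))
    nlinarith [mul_nonneg h h, mul_nonneg (mul_nonneg h h) h, mul_nonneg (mul_nonneg h h) (by linarith : 0 ≤ 1 / 2 - w), mul_nonneg (mul_nonneg (mul_nonneg h h) h) (by linarith : 0 ≤ 1 / 2 - w), mul_nonneg (mul_nonneg (mul_nonneg (mul_nonneg h h) h) h) (by linarith : 0 ≤ 1 / 2 - w)]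
  · have := Real.add_one_le_exp (w + w ^ 2)
    refine le_trans ?_ (mul_le_mul_of_nonneg_right this (by linarith))
    nlinarith [mul_nonneg (mul_nonneg (neg_nonneg.2 h) (neg_nonneg.2 h)) (neg_nonneg.2 h)]

/-- The weight only changes the exponent of the Gaussian density from 1/(2v) to b = 1/(2v) - s, so
the integral is (1 - 2sv)^{-1/2}; the preceding inequality is then used with w = 2sv. -/
lemma integrable_exp_mul_sq_gaussianReal {v : NNReal} {s : ℝ} (hs : |s| * v ≤ 1 / 4) :
    Integrable (fun x => Real.exp (s * x ^ 2)) (gaussianReal 0 v) ∧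
    ∫ x, Real.exp (s * x ^ 2) ∂(gaussianReal 0 v) ≤ Real.exp (s * v + 2 * s ^ 2 * v ^ 2) := by
  rcases eq_or_ne v 0 with rfl | hv
  · simp [gaussianReal_zero_var, integrable_dirac]
  have hv0 : (0 : ℝ) < v := lt_of_le_of_ne v.2 (fun h => hv (NNReal.coe_eq_zero.1 h.symm))
  have hu : |s * v| ≤ 1 / 4 := by rwa [abs_mul, abs_of_pos hv0]
  have hu' := abs_le.1 hu
  set b : ℝ := (1 - 2 * (s * v)) / (2 * v) with hb
  have hbpos : 0 < b := by rw [hb]; apply div_pos <;> linarith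
  have key : ∀ x : ℝ, gaussianPDFReal 0 v x * Real.exp (s * x ^ 2)
      = (Real.sqrt (2 * Real.pi * v))⁻¹ * Real.exp (-b * x ^ 2) := by
    intro x
    rw [gaussianPDFReal, mul_assoc, ← Real.exp_add]
    congr 2
    rw [hb]; field_simp; ring
  constructor
  · rw [gaussianReal_of_var_ne_zero _ hv, integrable_withDensity_iff_integrable_smul' (by fun_prop)
      (ae_of_all _ fun x => by simp [gaussianPDF])]
    simp only [toReal_gaussianPDF, smul_eq_mul]
    simp_rw [key]
    exact (integrable_exp_neg_mul_sq hbpos).const_mul _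
  · rw [integral_gaussianReal_eq_integral_smul hv]
    simp only [smul_eq_mul]
    simp_rw [key]
    rw [integral_const_mul, integral_gaussian]
    have hw : |2 * (s * v)| ≤ 1 / 2 := by rw [abs_mul, abs_two]; linarith
    have h1 := inv_one_sub_le_exp hw
    have : (Real.sqrt (2 * Real.pi * v))⁻¹ * Real.sqrt (Real.pi / b)
        = Real.sqrt ((1 - 2 * (s * v))⁻¹) := by
      rw [← Real.sqrt_inv, ← Real.sqrt_mul (by positivity)]
      congr 1
      have : (1 - 2 * (s * v)) ≠ 0 := by linarith
      rw [hb]; field_simp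
    rw [this]
    calc Real.sqrt ((1 - 2 * (s * v))⁻¹) ≤ Real.sqrt (Real.exp (2 * (s * v) + (2 * (s * v)) ^ 2)) :=
          Real.sqrt_le_sqrt h1
      _ = Real.exp (s * v + 2 * s ^ 2 * v ^ 2) := by
          rw [Real.sqrt_eq_iff_mul_self_eq (by positivity) (by positivity), ← Real.exp_add]
          congr 1; ring

variable {Ω : Type*} [MeasurableSpace Ω] {P : Measure Ω}

lemma mgf_sq_le {W : Ω → ℝ} (hW : HasGaussianLaw W P) (h0 : ∫ ω, W ω ∂P = 0) {s l : ℝ}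
    (hl : ∫ ω, W ω ^ 2 ∂P = l) (hs : |s| * l ≤ 1 / 4) :
    Integrable (fun ω => Real.exp (s * W ω ^ 2)) P ∧
    mgf (fun ω => W ω ^ 2) P s ≤ Real.exp (s * l + 2 * s ^ 2 * l ^ 2) := by
  have hm := hW.map_eq_gaussianReal
  have hvar : Var[W; P] = l := by
    rw [variance_eq_integral hW.aemeasurable]
    simpa [h0] using hl
  have hl0 : 0 ≤ l := hl ▸ integral_nonneg fun ω => sq_nonneg _
  rw [h0, hvar] at hm
  have hc : ((l.toNNReal : NNReal) : ℝ) = l := Real.coe_toNNReal _ hl0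
  obtain ⟨h1, h2⟩ := integrable_exp_mul_sq_gaussianReal (v := l.toNNReal) (s := s) (by rwa [hc])
  rw [← hm] at h1 h2
  rw [hc] at h2
  refine ⟨(integrable_map_measure (by fun_prop) hW.aemeasurable).1 h1, ?_⟩
  rwa [integral_map hW.aemeasurable (by fun_prop)] at h2

/-- Chernoff's bound on each tail, the moment generating functions multiplying by independence. Only
the largest variance and their sum enter, through ∑ lᵢ² ≤ M ∑ lᵢ, so the number of variables does
not appear. -/
lemma measure_abs_sum_sq_sub_ge_le_of_indep {ι : Type*} [Fintype ι] {W : ι → Ω → ℝ}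
    (hW : ∀ i, HasGaussianLaw (W i) P) (hind : iIndepFun W P)
    (h0 : ∀ i, ∫ ω, W i ω ∂P = 0) {M K t : ℝ} (hM : 0 < M) (hK : 0 < K)
    (hV : ∀ i, ∫ ω, W i ω ^ 2 ∂P ≤ M) (hT : ∑ i, ∫ ω, W i ω ^ 2 ∂P ≤ K * M)
    (ht : 0 ≤ t) (htM : t ≤ 6 * K * M) :
    P.real {ω | t ≤ |∑ i, W i ω ^ 2 - ∑ i, ∫ ω, W i ω ^ 2 ∂P|}
      ≤ 2 * Real.exp (-(t ^ 2 / (32 * K * M ^ 2))) := by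
  have := hind.isProbabilityMeasure
  set l : ι → ℝ := fun i => ∫ ω, W i ω ^ 2 ∂P with hl
  have hl0 : ∀ i, 0 ≤ l i := fun i => integral_nonneg fun ω => sq_nonneg _
  have hind2 : iIndepFun (fun i ω => W i ω ^ 2) P :=
    hind.comp (fun _ x => x ^ 2) (fun _ => by fun_prop)
  have hmeas : ∀ i, AEMeasurable (fun ω => W i ω ^ 2) P := fun i => (hW i).aemeasurable.pow_const 2
  have hmgf : ∀ s : ℝ, |s| * M ≤ 1 / 4 →
      Integrable (fun ω => Real.exp (s * (∑ i, fun ω => W i ω ^ 2) ω)) P ∧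
      mgf (∑ i, fun ω => W i ω ^ 2) P s ≤ Real.exp (s * ∑ i, l i + 2 * s ^ 2 * (K * M ^ 2)) := by
    intro s hs
    have hsi : ∀ i, |s| * l i ≤ 1 / 4 := fun i =>
      (mul_le_mul_of_nonneg_left (hV i) (abs_nonneg s)).trans hs
    have hi := fun i => mgf_sq_le (hW i) (h0 i) (l := l i) rfl (hsi i)
    refine ⟨?_, ?_⟩
    -- A non-integrable exponential would give `mgf` its default value 0, whereas the product of the
    -- factors is positive.
    · by_contra hn
      have h1 : 0 < ∏ i, mgf (fun ω => W i ω ^ 2) P s :=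
        Finset.prod_pos fun i _ => mgf_pos (hi i).1
      rw [← hind2.mgf_sum₀ hmeas, mgf_undef hn] at h1
      exact h1.false
    · rw [hind2.mgf_sum₀ hmeas]
      calc ∏ i, mgf (fun ω => W i ω ^ 2) P s ≤ ∏ i, Real.exp (s * l i + 2 * s ^ 2 * l i ^ 2) :=
            Finset.prod_le_prod (fun i _ => mgf_nonneg) fun i _ => (hi i).2
        _ = Real.exp (s * ∑ i, l i + 2 * s ^ 2 * ∑ i, l i ^ 2) := by
            rw [← Real.exp_sum, Finset.sum_add_distrib, Finset.mul_sum, Finset.mul_sum]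
        _ ≤ _ := by
            have : ∑ i, l i ^ 2 ≤ K * M ^ 2 := by
              calc ∑ i, l i ^ 2 ≤ ∑ i, M * l i := Finset.sum_le_sum fun i _ => by
                    nlinarith [hV i, hl0 i]
                _ = M * ∑ i, l i := by rw [Finset.mul_sum]
                _ ≤ M * (K * M) := mul_le_mul_of_nonneg_left hT hM.le
                _ = _ := by ring
            gcongr
  -- Not the unconstrained optimum t/(4KM²): this choice keeps sM ≤ 1/4 on the whole range t ≤ 6KM.
  -- The resulting constant 1/24 - 2/576 = 22/576 still exceeds 1/32.
  set s : ℝ := t / (24 * K * M ^ 2) with hs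
  have hs0 : 0 ≤ s := by positivity
  have hsM : |s| * M ≤ 1 / 4 := by
    rw [abs_of_nonneg hs0, hs, div_mul_eq_mul_div, div_le_iff₀ (by positivity)]
    nlinarith
  have hsM' : |(-s)| * M ≤ 1 / 4 := by rwa [abs_neg]
  have hexp : -s * t + 2 * s ^ 2 * (K * M ^ 2) ≤ -(t ^ 2 / (32 * K * M ^ 2)) := by
    have e1 : -s * t + 2 * s ^ 2 * (K * M ^ 2) = -(t ^ 2 / (K * M ^ 2)) * (1 / 24 - 2 / 576) := by
      rw [hs]; field_simp; ring
    have e2 : -(t ^ 2 / (32 * K * M ^ 2)) = -(t ^ 2 / (K * M ^ 2)) * (1 / 32) := by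
      field_simp
    rw [e1, e2]
    have : 0 ≤ t ^ 2 / (K * M ^ 2) := by positivity
    linarith
  have hup := measure_ge_le_exp_mul_mgf (μ := P) (∑ i, l i + t) hs0 (hmgf s hsM).1
  have hlo := measure_le_le_exp_mul_mgf (μ := P) (∑ i, l i - t) (by linarith : -s ≤ 0)
    (hmgf (-s) hsM').1
  have hup' : P.real {ω | ∑ i, l i + t ≤ (∑ i, fun ω => W i ω ^ 2) ω}
      ≤ Real.exp (-(t ^ 2 / (32 * K * M ^ 2))) := by
    refine hup.trans ((mul_le_mul_of_nonneg_left (hmgf s hsM).2 (Real.exp_pos _).le).trans ?_)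
    rw [← Real.exp_add]
    exact Real.exp_le_exp.2 (by linarith)
  have hlo' : P.real {ω | (∑ i, fun ω => W i ω ^ 2) ω ≤ ∑ i, l i - t}
      ≤ Real.exp (-(t ^ 2 / (32 * K * M ^ 2))) := by
    refine hlo.trans ((mul_le_mul_of_nonneg_left (hmgf (-s) hsM').2 (Real.exp_pos _).le).trans ?_)
    rw [← Real.exp_add]
    exact Real.exp_le_exp.2 (by linarith)
  refine le_trans (le_trans (measureReal_mono (fun ω hω => ?_)) (measureReal_union_le
    {ω | ∑ i, l i + t ≤ (∑ i, fun ω => W i ω ^ 2) ω}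
    {ω | (∑ i, fun ω => W i ω ^ 2) ω ≤ ∑ i, l i - t})) (by linarith)
  simp only [Set.mem_ofPred_eq, Set.mem_union, Finset.sum_apply, le_abs] at hω ⊢
  rcases hω with h | h
  · left; linarith
  · right; linarith

/-- Concentration of the squared norm of a centred Gaussian vector whose covariance is bounded
by `M` in operator norm and by `K * M` in trace. -/
lemma measure_abs_sum_sq_sub_ge_le {ι : Type*} [Fintype ι] {Z : ι → Ω → ℝ}
    (hZ : HasGaussianLaw (fun ω => (Z · ω)) P)
    (h0 : ∀ i, ∫ ω, Z i ω ∂P = 0) {M K t : ℝ} (hM : 0 < M) (hK : 0 < K)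
    (hV : ∀ c : ι → ℝ, ∫ ω, (∑ i, c i * Z i ω) ^ 2 ∂P ≤ M * ∑ i, c i ^ 2)
    (hT : ∑ i, ∫ ω, Z i ω ^ 2 ∂P ≤ K * M) (ht : 0 ≤ t) (htM : t ≤ 6 * K * M) :
    P.real {ω | t ≤ |∑ i, Z i ω ^ 2 - ∑ i, ∫ ω, Z i ω ^ 2 ∂P|}
      ≤ 2 * Real.exp (-(t ^ 2 / (32 * K * M ^ 2))) := by
  classical
  have hZ2 : ∀ i, MemLp (Z i) 2 P := fun i => (hZ.eval i).memLp_two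
  have hZint : ∀ i, Integrable (Z i) P := fun i => (hZ.eval i).integrable
  have := hZ.isProbabilityMeasure
  let S : Matrix ι ι ℝ := Matrix.of fun i j => ∫ ω, Z i ω * Z j ω ∂P
  have hS : S.IsHermitian := by
    ext i j
    simp only [S, Matrix.conjTranspose_apply, Matrix.of_apply, star_trivial]
    exact integral_congr_ae (ae_of_all _ fun ω => mul_comm _ _)
  -- In an orthonormal eigenbasis of the covariance the coordinates are uncorrelated, hence
  -- independent by joint Gaussianity, while the squared length and the trace are unchanged.
  let b := hS.eigenvectorBasis
  let W : ι → Ω → ℝ := fun k ω => ∑ i, b k i * Z i ω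
  have hWG : HasGaussianLaw (fun ω => (W · ω)) P := by
    let L : (ι → ℝ) →L[ℝ] (ι → ℝ) := ContinuousLinearMap.pi fun k =>
      ∑ i, (b k i) • ContinuousLinearMap.proj (R := ℝ) (φ := fun _ : ι => ℝ) i
    have hL : (fun ω => (W · ω)) = fun ω => L (Z · ω) := by
      ext ω k
      simp [L, W]
    rw [hL]
    exact hZ.map_fun L
  have hW0 : ∀ k, ∫ ω, W k ω ∂P = 0 := fun k => by
    simp only [W]
    rw [integral_finsetSum _ fun i _ => (hZint i).const_mul _]
    simp [integral_const_mul, h0]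
  have hWW : ∀ k l, ∫ ω, W k ω * W l ω ∂P = ∑ i, b k i * ∑ j, S i j * b l j := by
    intro k l
    simp only [W, Finset.sum_mul_sum]
    rw [integral_finsetSum]
    · refine Finset.sum_congr rfl fun i _ => ?_
      rw [integral_finsetSum, Finset.mul_sum]
      · refine Finset.sum_congr rfl fun j _ => ?_
        simp only [S, Matrix.of_apply]
        rw [← integral_mul_const, ← integral_const_mul]
        exact integral_congr_ae (ae_of_all _ fun ω => by ring)
      · intro j _
        have := ((hZ2 i).integrable_mul (hZ2 j)).const_mul (b k i * b l j)
        refine this.congr (ae_of_all _ fun ω => ?_)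
        simp only [Pi.mul_apply]; ring
    · intro i _
      refine integrable_finsetSum _ fun j _ => ?_
      have := ((hZ2 i).integrable_mul (hZ2 j)).const_mul (b k i * b l j)
      refine this.congr (ae_of_all _ fun ω => ?_)
      simp only [Pi.mul_apply]; ring
  have hcov : ∀ k l, k ≠ l → ∫ ω, W k ω * W l ω ∂P = 0 := by
    intro k l hkl
    have h1 := hS.mulVec_eigenvectorBasis l
    have h2 : ∀ i, ∑ j, S i j * b l j = hS.eigenvalues l * b l i := fun i => by
      have := congrFun h1 i
      simpa [Matrix.mulVec, dotProduct] using this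
    rw [hWW]
    simp_rw [h2]
    have h3 : inner ℝ (b l) (b k) = 0 := b.orthonormal.2 hkl.symm
    rw [PiLp.inner_apply] at h3
    simp only [RCLike.inner_apply, conj_trivial] at h3
    calc ∑ i, b k i * (hS.eigenvalues l * b l i) = hS.eigenvalues l * ∑ i, b k i * b l i := by
          rw [Finset.mul_sum]; exact Finset.sum_congr rfl fun i _ => by ring
      _ = 0 := by rw [h3, mul_zero]
  have hWk : ∀ k, HasGaussianLaw (W k) P := fun k => hWG.eval k
  have hind : iIndepFun W P := hWG.iIndepFun_of_covariance_eq_zero fun k l hkl => by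
    rw [covariance_eq_sub (hWk k).memLp_two (hWk l).memLp_two]
    simp [hW0, hcov k l hkl]
  have hnorm : ∀ ω, ∑ k, W k ω ^ 2 = ∑ i, Z i ω ^ 2 := fun ω => by
    have := b.sum_sq_norm_inner_right (WithLp.toLp 2 (fun i => Z i ω))
    rw [EuclideanSpace.norm_sq_eq] at this
    simp only [PiLp.inner_apply, RCLike.inner_apply, conj_trivial, Real.norm_eq_abs, sq_abs] at this
    rw [← this]
    refine Finset.sum_congr rfl fun k _ => ?_
    simp only [W]
    congr 1
    exact Finset.sum_congr rfl fun i _ => mul_comm _ _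
  have hsum : ∑ k, ∫ ω, W k ω ^ 2 ∂P = ∑ i, ∫ ω, Z i ω ^ 2 ∂P := by
    rw [← integral_finsetSum _ fun i _ => (hZ2 i).integrable_sq,
      ← integral_finsetSum _ fun i _ => (hWk i).memLp_two.integrable_sq]
    simp_rw [hnorm]
  have hb1 : ∀ k, ∑ i, b k i ^ 2 = 1 := fun k => by
    have := EuclideanSpace.norm_sq_eq (b k)
    rw [b.orthonormal.1 k] at this
    simpa using this.symm
  have := measure_abs_sum_sq_sub_ge_le_of_indep hWk hind hW0 hM hK
    (fun k => by simpa [hb1 k] using hV (b k)) (hsum ▸ hT) ht htM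
  simpa only [hnorm, hsum] using this

end DDAG

/-! ### Nets of the complex sphere and quadratic forms of Hermitian matrices. -/

namespace DDAG

/-- The unit sphere of `ℂ^p` has a `1/2`-net with at most `25 ^ p` points. -/
lemma exists_net (p : ℕ) : ∃ s : Finset (EuclideanSpace ℂ (Fin p)), s.card ≤ 25 ^ p ∧
    (∀ v ∈ s, ‖v‖ = 1) ∧ ∀ u : EuclideanSpace ℂ (Fin p), ‖u‖ = 1 → ∃ v ∈ s, ‖v - u‖ ≤ 1 / 2 := by
  classical
  let Q : Finset (EuclideanSpace ℂ (Fin p)) → Prop := fun s =>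
    (∀ v ∈ s, ‖v‖ = 1) ∧ ∀ v ∈ s, ∀ u ∈ s, v ≠ u → 1 / 2 ≤ ‖v - u‖
  have hcard : ∀ s, Q s → s.card ≤ 25 ^ p := by
    intro s hs
    have h2 : Function.Injective fun v : EuclideanSpace ℂ (Fin p) => (2 : ℝ) • v :=
      smul_right_injective _ two_ne_zero
    -- Doubling turns a 1/2-separated subset of the unit sphere into a 1-separated subset of the
    -- ball of radius 2, which has at most 5^d points; here d = 2p is the real dimension.
    have := Besicovitch.card_le_of_separated (s.image fun v => (2 : ℝ) • v)
      (by
        simp only [Finset.mem_image]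
        rintro _ ⟨v, hv, rfl⟩
        rw [norm_smul, hs.1 v hv]; norm_num)
      (by
        simp only [Finset.mem_image]
        rintro _ ⟨v, hv, rfl⟩ _ ⟨u, hu, rfl⟩ hne
        have := hs.2 v hv u hu (fun h => hne (by rw [h]))
        rw [← smul_sub, norm_smul]; norm_num; linarith)
    rw [Finset.card_image_of_injective _ h2, finrank_real_of_complex, finrank_euclideanSpace,
      Fintype.card_fin, pow_mul] at this
    simpa using this
  let A : Set ℕ := {k | ∃ s, Q s ∧ s.card = k}
  have hA : A.Nonempty := ⟨0, ∅, by simp [Q], by simp⟩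
  have hbdd : BddAbove A := ⟨25 ^ p, by rintro _ ⟨s, hs, rfl⟩; exact hcard s hs⟩
  -- A separated set of maximal cardinality is a net, since an uncovered point could be added to it.
  obtain ⟨s, hs, hsc⟩ := Nat.sSup_mem hA hbdd
  refine ⟨s, hcard s hs, hs.1, fun u hu => ?_⟩
  by_contra! hcon
  have hus : u ∉ s := fun h => by
    have := hcon u h
    rw [sub_self, norm_zero] at this
    norm_num at this
  have hQ : Q (insert u s) := by
    refine ⟨fun v hv => ?_, fun v hv w hw hvw => ?_⟩
    · rcases Finset.mem_insert.1 hv with rfl | hv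
      exacts [hu, hs.1 v hv]
    · rcases Finset.mem_insert.1 hv with hv' | hv' <;>
        rcases Finset.mem_insert.1 hw with hw' | hw'
      · exact absurd (hv'.trans hw'.symm) hvw
      · rw [norm_sub_rev, hv']; exact (hcon w hw').le
      · rw [hw']; exact (hcon v hv').le
      · exact hs.2 v hv' w hw' hvw
  have := le_csSup hbdd (⟨_, hQ, rfl⟩ : (insert u s).card ∈ A)
  rw [Finset.card_insert_of_notMem hus] at this
  omega

lemma inner_toEuclideanCLM_eq {p : ℕ} (A : Matrix (Fin p) (Fin p) ℂ)
    (v : EuclideanSpace ℂ (Fin p)) :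
    inner ℂ v (Matrix.toEuclideanCLM (n := Fin p) (𝕜 := ℂ) A v)
      = star (v : Fin p → ℂ) ⬝ᵥ A.mulVec v := by
  rw [EuclideanSpace.inner_eq_star_dotProduct, Matrix.ofLp_toEuclideanCLM, dotProduct_comm]

lemma norm_star_dotProduct_mulVec_le {p : ℕ} (A : Matrix (Fin p) (Fin p) ℂ)
    (v : EuclideanSpace ℂ (Fin p)) :
    ‖star (v : Fin p → ℂ) ⬝ᵥ A.mulVec v‖ ≤ ‖A‖ * ‖v‖ ^ 2 := by
  rw [← inner_toEuclideanCLM_eq, Matrix.cstar_norm_def]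
  calc _ ≤ ‖v‖ * ‖Matrix.toEuclideanCLM (n := Fin p) (𝕜 := ℂ) A v‖ := norm_inner_le_norm _ _
    _ ≤ ‖v‖ * (‖Matrix.toEuclideanCLM (n := Fin p) (𝕜 := ℂ) A‖ * ‖v‖) := by
        gcongr; exact ContinuousLinearMap.le_opNorm _ _
    _ = _ := by ring

/-- The spectral norm of a Hermitian matrix is controlled by its quadratic form on a
`1/2`-net of the unit sphere. -/
lemma exists_norm_le_two_mul_quadratic {p : ℕ} (hp : p ≠ 0) {A : Matrix (Fin p) (Fin p) ℂ}
    (hA : A.IsHermitian) {s : Finset (EuclideanSpace ℂ (Fin p))} (hs1 : ∀ v ∈ s, ‖v‖ = 1)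
    (hs : ∀ u : EuclideanSpace ℂ (Fin p), ‖u‖ = 1 → ∃ v ∈ s, ‖v - u‖ ≤ 1 / 2) :
    ∃ v ∈ s, ‖A‖ ≤ 2 * ‖star (v : Fin p → ℂ) ⬝ᵥ A.mulVec v‖ := by
  have : NeZero p := ⟨hp⟩
  set T := Matrix.toEuclideanCLM (n := Fin p) (𝕜 := ℂ) A with hT
  obtain ⟨i, hi⟩ : ∃ i, |hA.eigenvalues i| = ‖A‖ := by
    have h := CStarAlgebra.norm_or_neg_norm_mem_spectrum (a := A) hA.isSelfAdjoint
    rw [hA.spectrum_real_eq_range_eigenvalues] at h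
    rcases h with ⟨i, hi⟩ | ⟨i, hi⟩
    · exact ⟨i, by rw [hi, abs_norm]⟩
    · exact ⟨i, by rw [hi, abs_neg, abs_norm]⟩
  set l := hA.eigenvalues i
  set u := hA.eigenvectorBasis i
  have hu : ‖u‖ = 1 := hA.eigenvectorBasis.orthonormal.1 i
  have hTu : T u = (l : ℂ) • u := by
    have := hA.mulVec_eigenvectorBasis i
    ext j
    rw [hT, Matrix.ofLp_toEuclideanCLM, this]
    simp [l, u]
  obtain ⟨v, hv, hvu⟩ := hs u hu
  refine ⟨v, hv, ?_⟩
  set d := v - u with hd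
  have hvd : v = u + d := by rw [hd]; abel
  have hsa : inner ℂ u (T d) = (l : ℂ) * inner ℂ u d := by
    have : inner ℂ (T u) d = inner ℂ u (T d) := by
      rw [← ContinuousLinearMap.adjoint_inner_right]
      congr 1
      have : ContinuousLinearMap.adjoint T = T := by
        rw [← ContinuousLinearMap.star_eq_adjoint, hT, ← map_star]
        congr 1
      rw [this]
    rw [← this, hTu, inner_smul_left]
    simp
  -- Since u and v are both unit vectors, 2 Re⟨u, d⟩ = -‖d‖². As u is an eigenvector for ±‖A‖, the
  -- error in the quadratic form is then of second order in d: the form at v is at least ‖A‖(1 -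
  -- 2‖d‖²), so radius 1/2 already gives the factor 2.
  have h1 : (1 : ℝ) = 1 + 2 * RCLike.re (inner ℂ u d) + ‖d‖ ^ 2 := by
    have := norm_add_sq (𝕜 := ℂ) u d
    rw [← hvd, hs1 v hv, hu] at this
    simpa using this
  have hre : inner ℂ u d + inner ℂ d u = ((-‖d‖ ^ 2 : ℝ) : ℂ) := by
    rw [← inner_conj_symm d u, Complex.add_conj]
    congr 1
    simp only [RCLike.re_to_complex] at h1
    linarith
  have hq : inner ℂ v (T v) = ((l * (1 - ‖d‖ ^ 2) : ℝ) : ℂ) + inner ℂ d (T d) := by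
    have huu : inner ℂ u u = (1 : ℂ) := by rw [inner_self_eq_norm_sq_to_K, hu]; simp
    calc inner ℂ v (T v) = inner ℂ u (T u) + inner ℂ d (T u) + (inner ℂ u (T d) + inner ℂ d (T d)) := by
          rw [hvd, map_add, inner_add_right, inner_add_left, inner_add_left]
      _ = l * (1 + (inner ℂ u d + inner ℂ d u)) + inner ℂ d (T d) := by
          rw [hsa, hTu, inner_smul_right, inner_smul_right, huu]; ring
      _ = _ := by rw [hre]; push_cast; ring
  have hdT : ‖inner ℂ d (T d)‖ ≤ ‖A‖ * ‖d‖ ^ 2 := by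
    rw [hT, inner_toEuclideanCLM_eq]; exact norm_star_dotProduct_mulVec_le A d
  have hd2 : ‖d‖ ^ 2 ≤ 1 / 4 := by nlinarith [norm_nonneg d]
  have hlow : ‖A‖ * (1 - ‖d‖ ^ 2) - ‖A‖ * ‖d‖ ^ 2 ≤ ‖inner ℂ v (T v)‖ := by
    rw [hq]
    refine le_trans ?_ (norm_sub_le_norm_add _ _)
    rw [Complex.norm_real, Real.norm_eq_abs, abs_mul, hi, abs_of_nonneg (by linarith)]
    linarith
  rw [← inner_toEuclideanCLM_eq, ← hT]
  nlinarith [norm_nonneg A]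

end DDAG

/-! ### Bias of the estimator. -/

namespace DDAG

/-- The Cesàro-type partial sums of a geometrically decaying bilateral series. -/
lemma norm_tsum_sub_mean_le {E : Type*} [NormedAddCommGroup E] [NormedSpace ℝ E] [CompleteSpace E]
    {F : ℤ → E} {C q : ℝ} (hC : 0 ≤ C) (hq0 : 0 < q) (hq1 : q < 1)
    (hF : ∀ k : ℤ, ‖F k‖ ≤ C * q ^ k.natAbs) {N : ℕ} (hN : N ≠ 0) :
    Summable F ∧
    ‖∑' k, F k - (1 / (N : ℝ)) • ∑ l ∈ Finset.range N, ∑ k ∈ Finset.range N, F ((k : ℤ) - l)‖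
      ≤ 2 * C * q / ((1 - q) ^ 2 * N) := by
  have hq : 0 < 1 - q := by linarith
  have hgeo : ∀ a : ℕ, HasSum (fun n : ℕ => C * q ^ (n + a)) (C * q ^ a / (1 - q)) := by
    intro a
    have := (hasSum_geometric_of_lt_one hq0.le hq1).mul_left (C * q ^ a)
    have he : (fun n : ℕ => C * q ^ (n + a)) = fun n => C * q ^ a * q ^ n := by
      ext n; rw [pow_add]; ring
    rwa [he, div_eq_mul_inv]
  have hsum : Summable F := by
    refine Summable.of_nat_of_neg_add_one ?_ ?_
    · refine Summable.of_norm_bounded (hgeo 0).summable fun n => ?_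
      simpa using hF n
    · refine Summable.of_norm_bounded (hgeo 1).summable fun n => ?_
      refine (hF _).trans_eq ?_
      congr 2
  refine ⟨hsum, ?_⟩
  -- The window of length N starting at -l omits a right tail beginning at N - l and a left tail
  -- beginning at distance l + 1. Summed over l, each family of tails is again a geometric sum.
  have hl : ∀ l ∈ Finset.range N, ‖∑' k, F k - ∑ k ∈ Finset.range N, F ((k : ℤ) - l)‖
      ≤ C * q ^ (N - l) / (1 - q) + C * q ^ (l + 1) / (1 - q) := by
    intro l hl
    have hlN := Finset.mem_range.1 hl
    have hs : Summable fun k : ℤ => F (k - l) := hsum.comp_injective (sub_left_injective)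
    have hn : Summable fun k : ℕ => F ((k : ℤ) - l) :=
      hs.comp_injective (i := fun k : ℕ => (k : ℤ)) Nat.cast_injective
    have hneg : Summable fun k : ℕ => F (-((k : ℤ) + 1) - l) :=
      hs.comp_injective (i := fun k : ℕ => (-((k : ℤ) + 1))) fun a b h => by
        simp only at h; omega
    have h1 : ∑' k, F k = ∑' k : ℤ, F (k - l) := ((Equiv.subRight (l : ℤ)).tsum_eq F).symm
    have h2 : ∑' k : ℤ, F (k - l) = ∑' k : ℕ, F ((k : ℤ) - l) + ∑' k : ℕ, F (-((k : ℤ) + 1) - l) :=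
      tsum_of_nat_of_neg_add_one hn hneg
    have h3 := hn.sum_add_tsum_nat_add N
    rw [h1, h2, ← h3, add_sub_right_comm, add_sub_cancel_left]
    refine (norm_add_le _ _).trans (add_le_add ?_ ?_)
    · refine tsum_of_norm_bounded (hgeo (N - l)) fun n => (hF _).trans_eq ?_
      congr 2; push_cast; omega
    · refine tsum_of_norm_bounded (hgeo (l + 1)) fun n => (hF _).trans_eq ?_
      congr 2; omega
  have hNpos : (0 : ℝ) < N := by positivity
  have heq : ∑' k, F k - (1 / (N : ℝ)) • ∑ l ∈ Finset.range N, ∑ k ∈ Finset.range N, F ((k : ℤ) - l)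
      = (1 / (N : ℝ)) • ∑ l ∈ Finset.range N, (∑' k, F k - ∑ k ∈ Finset.range N, F ((k : ℤ) - l)) := by
    rw [Finset.sum_sub_distrib, smul_sub, Finset.sum_const, Finset.card_range, ← Nat.cast_smul_eq_nsmul ℝ,
      smul_smul, one_div, inv_mul_cancel₀ hNpos.ne', one_smul]
  have hS : ∑ l ∈ Finset.range N, q ^ l ≤ 1 / (1 - q) := by
    rw [one_div]
    exact sum_le_hasSum _ (fun i _ => by positivity) (hasSum_geometric_of_lt_one hq0.le hq1)
  have hA : ∑ l ∈ Finset.range N, q ^ (l + 1) ≤ q / (1 - q) := by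
    simp_rw [pow_succ, ← Finset.sum_mul]
    calc _ ≤ 1 / (1 - q) * q := by gcongr
      _ = _ := by ring
  have hB : ∑ l ∈ Finset.range N, q ^ (N - l) ≤ q / (1 - q) := by
    rw [← Finset.sum_range_reflect]
    refine le_of_eq_of_le (Finset.sum_congr rfl fun l hl => ?_) hA
    have := Finset.mem_range.1 hl
    congr 1; omega
  rw [heq, norm_smul, Real.norm_of_nonneg (by positivity)]
  calc 1 / (N : ℝ) * ‖∑ l ∈ Finset.range N, (∑' k, F k - ∑ k ∈ Finset.range N, F ((k : ℤ) - l))‖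
      ≤ 1 / (N : ℝ) * ∑ l ∈ Finset.range N, (C * q ^ (N - l) / (1 - q) + C * q ^ (l + 1) / (1 - q)) := by
        gcongr; exact norm_sum_le_of_le _ hl
    _ = 1 / (N : ℝ) * (C / (1 - q) * (∑ l ∈ Finset.range N, q ^ (N - l)
          + ∑ l ∈ Finset.range N, q ^ (l + 1))) := by
        rw [← Finset.sum_add_distrib, Finset.mul_sum _ _ (C / (1 - q))]
        congr 1
        exact Finset.sum_congr rfl fun l _ => by ring
    _ ≤ 1 / (N : ℝ) * (C / (1 - q) * (q / (1 - q) + q / (1 - q))) := by gcongr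
    _ = _ := by field_simp; ring

/-- A real matrix acts separately on real and imaginary parts, whose squared norms add. -/
lemma norm_map_ofReal_le {p : ℕ} (A : Matrix (Fin p) (Fin p) ℝ) :
    ‖A.map (fun r : ℝ => (r : ℂ))‖ ≤ ‖A‖ := by
  rw [Matrix.cstar_norm_def]
  refine ContinuousLinearMap.opNorm_le_bound _ (norm_nonneg A) fun z => ?_
  let a : EuclideanSpace ℝ (Fin p) := WithLp.toLp 2 fun i => (z i).re
  let b : EuclideanSpace ℝ (Fin p) := WithLp.toLp 2 fun i => (z i).im
  have hz : ‖z‖ ^ 2 = ‖a‖ ^ 2 + ‖b‖ ^ 2 := by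
    simp only [EuclideanSpace.norm_sq_eq, ← Finset.sum_add_distrib]
    refine Finset.sum_congr rfl fun i _ => ?_
    rw [Complex.sq_norm, Complex.normSq_apply]
    simp [a, b, sq]
  have hA : ‖Matrix.toEuclideanCLM (n := Fin p) (𝕜 := ℂ) (A.map (fun r : ℝ => (r : ℂ))) z‖ ^ 2
      = ‖Matrix.toEuclideanCLM (n := Fin p) (𝕜 := ℝ) A a‖ ^ 2
        + ‖Matrix.toEuclideanCLM (n := Fin p) (𝕜 := ℝ) A b‖ ^ 2 := by
    simp only [EuclideanSpace.norm_sq_eq, ← Finset.sum_add_distrib, Matrix.ofLp_toEuclideanCLM]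
    refine Finset.sum_congr rfl fun i _ => ?_
    rw [Complex.sq_norm, Complex.normSq_apply]
    simp [a, b, sq, Matrix.mulVec, dotProduct]
  have h1 := ContinuousLinearMap.le_opNorm (Matrix.toEuclideanCLM (n := Fin p) (𝕜 := ℝ) A) a
  have h2 := ContinuousLinearMap.le_opNorm (Matrix.toEuclideanCLM (n := Fin p) (𝕜 := ℝ) A) b
  rw [← Matrix.cstar_norm_def] at h1 h2
  refine le_of_sq_le_sq ?_ (by positivity)
  rw [hA, mul_pow, hz, mul_add, ← mul_pow, ← mul_pow]
  gcongr

variable {Ω : Type*} [MeasurableSpace Ω] {P : Measure Ω} {p N : ℕ} {x : ℤ → Ω → Fin p → ℝ}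

/-- The summand `R_x(k) e^{-iθk}` of the power spectral density matrix. -/
noncomputable def psdmTerm (P : Measure Ω) (x : ℤ → Ω → Fin p → ℝ) (θ : ℝ) (k : ℤ) :
    Matrix (Fin p) (Fin p) ℂ :=
  Complex.exp (-(Complex.I * θ * k)) • (autocorr P x k).map (fun r : ℝ => (r : ℂ))

/-- The expectation of the spectrogram estimator. -/
noncomputable def meanPsdm (P : Measure Ω) (x : ℤ → Ω → Fin p → ℝ) (N : ℕ) (θ : ℝ) :
    Matrix (Fin p) (Fin p) ℂ :=
  (1 / (N : ℝ)) • ∑ l ∈ Finset.range N, ∑ k ∈ Finset.range N, psdmTerm P x θ ((k : ℤ) - l)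

lemma norm_exp_neg_I_mul (θ : ℝ) (k : ℤ) : ‖Complex.exp (-(Complex.I * θ * k))‖ = 1 := by
  have : -(Complex.I * θ * k) = ((-(θ * k) : ℝ) : ℂ) * Complex.I := by push_cast; ring
  rw [this, Complex.norm_exp_ofReal_mul_I]

lemma AutocorrDecay.norm_le {C ρ : ℝ} (hR : AutocorrDecay P x C ρ) (k : ℤ) :
    ‖autocorr P x k‖ ≤ C * ρ⁻¹ ^ k.natAbs := by
  refine (hR.2.2 k).trans_eq ?_
  rw [zpow_neg, Int.abs_eq_natAbs, zpow_natCast, inv_pow]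

lemma AutocorrDecay.norm_psdmTerm_le {C ρ : ℝ} (hR : AutocorrDecay P x C ρ) (θ : ℝ) (k : ℤ) :
    ‖psdmTerm P x θ k‖ ≤ C * ρ⁻¹ ^ k.natAbs := by
  rw [psdmTerm, norm_smul, norm_exp_neg_I_mul, one_mul]
  exact (norm_map_ofReal_le _).trans (hR.norm_le k)

lemma AutocorrDecay.bias {C ρ : ℝ} (hR : AutocorrDecay P x C ρ) (θ : ℝ) (hN : N ≠ 0) :
    Summable (psdmTerm P x θ) ∧ psdm P x θ = ∑' k, psdmTerm P x θ k ∧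
    ‖psdm P x θ - meanPsdm P x N θ‖ ≤ 2 * C * ρ⁻¹ / ((1 - ρ⁻¹) ^ 2 * N) := by
  have hρ := hR.2.1
  have h := norm_tsum_sub_mean_le hR.1.le (inv_pos.2 (by linarith)) (inv_lt_one_of_one_lt₀ hρ)
    (hR.norm_psdmTerm_le θ) hN
  have he : psdm P x θ = ∑' k, psdmTerm P x θ k := by
    ext i j
    have h1 := h.1.hasSum.map (Matrix.entryAddMonoidHom ℂ i j)
      (by exact (continuous_apply j).comp (continuous_apply i))
    have h2 := h1.tsum_eq
    simp only [Matrix.entryAddMonoidHom_apply, Function.comp_def] at h2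
    rw [← h2]
    simp [psdm, psdmTerm, mul_comm]
  exact ⟨h.1, he, he ▸ h.2⟩

end DDAG

/-! ### Block Toeplitz forms and their symbols. -/

namespace DDAG

lemma integral_exp_I_mul_int (m : ℤ) :
    ∫ θ in (0 : ℝ)..2 * Real.pi, Complex.exp (Complex.I * θ * m)
      = if m = 0 then 2 * Real.pi else 0 := by
  split_ifs with h
  · simp [h]
  · have hc : Complex.I * (m : ℂ) ≠ 0 := mul_ne_zero Complex.I_ne_zero (by exact_mod_cast h)
    have h1 := integral_exp_mul_complex (a := 0) (b := 2 * Real.pi) hc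
    have h2 : Complex.exp (Complex.I * m * ((2 * Real.pi : ℝ) : ℂ)) = 1 := by
      rw [← Complex.exp_int_mul_two_pi_mul_I m]
      congr 1; push_cast; ring
    rw [h2] at h1
    simp only [Complex.ofReal_zero, mul_zero, Complex.exp_zero, sub_self, zero_div] at h1
    rw [Complex.ofReal_zero, ← h1]
    congr 1; ext θ; congr 1; ring

lemma integral_fourierSeries_mul_exp {a : ℤ → ℂ} (ha : Summable fun k => ‖a k‖) (m : ℤ) :
    ∫ θ in (0 : ℝ)..2 * Real.pi,
        (∑' k, a k * Complex.exp (-(Complex.I * θ * k))) * Complex.exp (Complex.I * θ * m)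
      = 2 * Real.pi * a m := by
  have hterm : ∀ (θ : ℝ) (k : ℤ), a k * Complex.exp (-(Complex.I * θ * k))
      * Complex.exp (Complex.I * θ * m) = a k * Complex.exp (Complex.I * θ * ((m - k : ℤ) : ℂ)) := by
    intro θ k
    rw [mul_assoc, ← Complex.exp_add]
    congr 2; push_cast; ring
  have hnorm : ∀ (θ : ℝ) (k : ℤ), ‖a k * Complex.exp (-(Complex.I * θ * k))‖ = ‖a k‖ := fun θ k => by
    rw [norm_mul, norm_exp_neg_I_mul, mul_one]
  have hs := intervalIntegral.hasSum_integral_of_dominated_convergence (μ := volume)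
    (a := 0) (b := 2 * Real.pi)
    (F := fun (k : ℤ) (θ : ℝ) => a k * Complex.exp (Complex.I * θ * ((m - k : ℤ) : ℂ)))
    (f := fun θ : ℝ => (∑' k, a k * Complex.exp (-(Complex.I * θ * k)))
      * Complex.exp (Complex.I * θ * m))
    (fun k _ => ‖a k‖) (fun k => by fun_prop)
    (fun k => ae_of_all _ fun θ _ => by
      have := norm_exp_neg_I_mul θ (k - m)
      rw [norm_mul, show Complex.I * θ * ((m - k : ℤ) : ℂ) = -(Complex.I * θ * ((k - m : ℤ) : ℂ)) by
        push_cast; ring, this, mul_one])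
    (ae_of_all _ fun θ _ => ha) (by simp)
    (ae_of_all _ fun θ _ => by
      have hsum : Summable fun k => a k * Complex.exp (-(Complex.I * θ * k)) :=
        Summable.of_norm (by simpa only [hnorm] using ha)
      have := hsum.hasSum.mul_right (Complex.exp (Complex.I * θ * m))
      simpa only [hterm] using this)
  rw [← hs.tsum_eq]
  simp_rw [intervalIntegral.integral_const_mul, integral_exp_I_mul_int]
  rw [tsum_eq_single m fun k hk => by simp [sub_eq_zero, hk.symm]]
  simp [mul_comm]

lemma continuous_fourierSeries {a : ℤ → ℂ} (ha : Summable fun k => ‖a k‖) :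
    Continuous fun θ : ℝ => ∑' k, a k * Complex.exp (-(Complex.I * θ * k)) :=
  continuous_tsum (fun k => by fun_prop) ha fun k θ => by
    rw [norm_mul, norm_exp_neg_I_mul, mul_one]

/-- The symbol `∑_k D_k e^{-iθk}` of a bilateral sequence of matrices. -/
noncomputable def symbol {p : ℕ} (D : ℤ → Matrix (Fin p) (Fin p) ℝ) (θ : ℝ) :
    Matrix (Fin p) (Fin p) ℂ :=
  Matrix.of fun i j => ∑' k : ℤ, (D k i j : ℂ) * Complex.exp (-(Complex.I * θ * k))

/-- A block Toeplitz form with positive semidefinite symbol is nonnegative. -/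
lemma toeplitz_nonneg {p : ℕ} {D : ℤ → Matrix (Fin p) (Fin p) ℝ}
    (hD : ∀ i j, Summable fun k => |D k i j|)
    (hpos : ∀ θ ∈ Set.Icc 0 (2 * Real.pi), ∀ v : Fin p → ℂ,
      0 ≤ (star v ⬝ᵥ (symbol D θ).mulVec v).re)
    {α : Type*} [Fintype α] (τ : α → ℤ) (c : α → Fin p) (u : α → ℝ) :
    0 ≤ ∑ a, ∑ b, u a * u b * D (τ a - τ b) (c a) (c b) := by
  have hsum : ∀ i j, Summable fun k => ‖(D k i j : ℂ)‖ := fun i j => by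
    simpa using hD i j
  -- With v(θ) = ∑ₐ uₐ e^{-iθτₐ} e_{cₐ}, orthogonality of exponentials makes the Toeplitz form equal
  -- to (1/2π) ∫ v(θ)* D̂(θ) v(θ) dθ, where D̂ is the symbol; the integrand has nonnegative real
  -- part.
  let w : ℝ → α → ℂ := fun θ a => (u a : ℂ) * Complex.exp (-(Complex.I * θ * τ a))
  let v : ℝ → Fin p → ℂ := fun θ j => ∑ a, if c a = j then w θ a else 0
  have hcollapse : ∀ (f : α → ℂ) (g : Fin p → ℂ),
      ∑ j, (∑ a, if c a = j then f a else 0) * g j = ∑ a, f a * g (c a) := by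
    intro f g
    simp_rw [Finset.sum_mul]
    rw [Finset.sum_comm]
    simp
  have hform : ∀ θ : ℝ, star (v θ) ⬝ᵥ (symbol D θ).mulVec (v θ)
      = ∑ a, ∑ b, ((u a * u b : ℝ) : ℂ) * ((symbol D θ (c a) (c b))
        * Complex.exp (Complex.I * θ * ((τ a - τ b : ℤ) : ℂ))) := by
    intro θ
    have hv : ∀ j, star (v θ) j = ∑ a, if c a = j then star (w θ a) else 0 := fun j => by
      simp only [v, Pi.star_apply, star_sum]
      exact Finset.sum_congr rfl fun a _ => by split_ifs <;> simp
    simp only [dotProduct, Matrix.mulVec, hv]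
    rw [hcollapse]
    refine Finset.sum_congr rfl fun a _ => ?_
    have : ∑ j, symbol D θ (c a) j * v θ j = ∑ b, w θ b * symbol D θ (c a) (c b) := by
      rw [← hcollapse]
      exact Finset.sum_congr rfl fun j _ => mul_comm _ _
    rw [this, Finset.mul_sum]
    refine Finset.sum_congr rfl fun b _ => ?_
    have hconj : star (w θ a) = u a * Complex.exp (Complex.I * θ * τ a) := by
      simp only [w]
      rw [Complex.star_def, map_mul, ← Complex.exp_conj]
      simp
    have hexp : Complex.exp (Complex.I * θ * ((τ a - τ b : ℤ) : ℂ))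
        = Complex.exp (Complex.I * θ * τ a) * Complex.exp (-(Complex.I * θ * τ b)) := by
      rw [← Complex.exp_add]; congr 1; push_cast; ring
    rw [hconj, hexp]
    simp only [w]
    push_cast; ring
  have hint : ∀ i j (m : ℤ), IntervalIntegrable
      (fun θ : ℝ => symbol D θ i j * Complex.exp (Complex.I * θ * m)) volume 0 (2 * Real.pi) :=
    fun i j m => by
      refine Continuous.intervalIntegrable ?_ _ _
      have := continuous_fourierSeries (hsum i j)
      simp only [symbol, Matrix.of_apply]
      fun_prop
  have hii : ∀ a b, IntervalIntegrable (fun θ : ℝ => ((u a * u b : ℝ) : ℂ)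
      * ((symbol D θ (c a) (c b)) * Complex.exp (Complex.I * θ * ((τ a - τ b : ℤ) : ℂ))))
      volume 0 (2 * Real.pi) := fun a b => (hint _ _ _).const_mul _
  have hii1 : ∀ a, IntervalIntegrable (fun θ : ℝ => ∑ b, ((u a * u b : ℝ) : ℂ)
      * ((symbol D θ (c a) (c b)) * Complex.exp (Complex.I * θ * ((τ a - τ b : ℤ) : ℂ))))
      volume 0 (2 * Real.pi) := fun a => by
    simpa only [Finset.sum_fn] using IntervalIntegrable.sum Finset.univ fun b _ => hii a b
  have hI : ∫ θ in (0 : ℝ)..2 * Real.pi, star (v θ) ⬝ᵥ (symbol D θ).mulVec (v θ)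
      = ((2 * Real.pi * ∑ a, ∑ b, u a * u b * D (τ a - τ b) (c a) (c b) : ℝ) : ℂ) := by
    simp_rw [hform]
    rw [intervalIntegral.integral_finsetSum fun a _ => hii1 a]
    simp_rw [fun a => intervalIntegral.integral_finsetSum
      (s := Finset.univ) (fun b _ => hii a b), intervalIntegral.integral_const_mul]
    simp only [symbol, Matrix.of_apply, integral_fourierSeries_mul_exp (hsum _ _)]
    push_cast
    rw [Finset.mul_sum]
    refine Finset.sum_congr rfl fun a _ => ?_
    rw [Finset.mul_sum]
    exact Finset.sum_congr rfl fun b _ => by ring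
  have hint' : IntervalIntegrable (fun θ : ℝ => star (v θ) ⬝ᵥ (symbol D θ).mulVec (v θ))
      volume 0 (2 * Real.pi) := by
    simp_rw [hform]
    simpa only [Finset.sum_fn] using IntervalIntegrable.sum Finset.univ fun a _ => hii1 a
  have hre : ∫ θ in (0 : ℝ)..2 * Real.pi, (star (v θ) ⬝ᵥ (symbol D θ).mulVec (v θ)).re
      = 2 * Real.pi * ∑ a, ∑ b, u a * u b * D (τ a - τ b) (c a) (c b) := by
    have := Complex.reCLM.intervalIntegral_comp_comm hint'
    simp only [Complex.reCLM_apply] at this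
    rw [this, hI, Complex.ofReal_re]
  have h0 : 0 ≤ 2 * Real.pi * ∑ a, ∑ b, u a * u b * D (τ a - τ b) (c a) (c b) := by
    rw [← hre]
    exact intervalIntegral.integral_nonneg (by positivity) fun θ hθ => hpos θ hθ _
  exact nonneg_of_mul_nonneg_right h0 (by positivity)

variable {Ω : Type*} [MeasurableSpace Ω] {P : Measure Ω} {p : ℕ} {x : ℤ → Ω → Fin p → ℝ}

/-- For a Hermitian matrix, ‖A‖ or -‖A‖ lies in the spectrum; the positive lower bound 1/M excludes
the second case. -/
lemma norm_psdm_le (hp : p ≠ 0) {M θ : ℝ} (hM : PSDMBound P x M)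
    (hθ : θ ∈ Set.Icc 0 (2 * Real.pi)) (hH : (psdm P x θ).IsHermitian) : ‖psdm P x θ‖ ≤ M := by
  have : NeZero p := ⟨hp⟩
  have hMpos : 0 < 1 / M := one_div_pos.2 hM.1
  rcases CStarAlgebra.norm_or_neg_norm_mem_spectrum (a := psdm P x θ) hH.isSelfAdjoint with h | h
  · exact (hM.2 θ hθ _ h).2
  · have := (hM.2 θ hθ _ h).1
    linarith [norm_nonneg (psdm P x θ)]

lemma isHermitian_psdm (hsym : ∀ k i j, autocorr P x (-k) i j = autocorr P x k j i)
    (θ : ℝ) : (psdm P x θ).IsHermitian := by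
  ext i j
  simp only [Matrix.conjTranspose_apply, psdm, Matrix.of_apply]
  rw [tsum_star, ← (Equiv.neg ℤ).tsum_eq]
  refine tsum_congr fun k => ?_
  rw [Equiv.neg_apply, star_mul', hsym, Complex.star_def, Complex.conj_ofReal,
    ← Complex.exp_conj]
  congr 2
  simp

lemma AutocorrDecay.summable_entry {C ρ : ℝ} (hR : AutocorrDecay P x C ρ) (i j : Fin p) :
    Summable fun k => |autocorr P x k i j| := by
  have h := (hR.bias 0 one_ne_zero).1
  have h1 : Summable fun k => psdmTerm P x 0 k i j :=
    (h.hasSum.map (Matrix.entryAddMonoidHom ℂ i j)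
      ((continuous_apply j).comp (continuous_apply i))).summable
  simpa [psdmTerm] using h1.norm

/-- The covariance form of a stationary process is bounded by the supremum of its power
spectral density. -/
lemma autocorr_form_le {M C ρ : ℝ} (hM : PSDMBound P x M) (hR : AutocorrDecay P x C ρ)
    (hsym : ∀ k i j, autocorr P x (-k) i j = autocorr P x k j i)
    {α : Type*} [Fintype α] {τ : α → ℤ} {c : α → Fin p}
    (hinj : Function.Injective fun a => (τ a, c a)) (u : α → ℝ) :
    ∑ a, ∑ b, u a * u b * autocorr P x (τ a - τ b) (c a) (c b) ≤ M * ∑ a, u a ^ 2 := by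
  classical
  rcases eq_or_ne p 0 with rfl | hp
  · have : IsEmpty α := c.isEmpty
    simp
  -- The symbol of M δ₀ I - R_x is M I - Φ_x, which is positive semidefinite.
  let D : ℤ → Matrix (Fin p) (Fin p) ℝ := fun k =>
    (if k = 0 then M • (1 : Matrix (Fin p) (Fin p) ℝ) else 0) - autocorr P x k
  have hδ : ∀ i j, HasSum (fun k : ℤ => (if k = 0 then M • (1 : Matrix (Fin p) (Fin p) ℝ) else 0) i j)
      (M * (1 : Matrix (Fin p) (Fin p) ℝ) i j) := fun i j => by
    have := hasSum_ite_eq (0 : ℤ) (M * (1 : Matrix (Fin p) (Fin p) ℝ) i j)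
    convert this using 2 with k
    split_ifs <;> simp
  have hD : ∀ i j, Summable fun k => |D k i j| := fun i j => by
    have h1 := (hδ i j).summable.sub (hR.summable_entry i j).of_abs
    exact h1.abs
  have hsymb : ∀ θ, symbol D θ = (M : ℂ) • (1 : Matrix (Fin p) (Fin p) ℂ) - psdm P x θ := by
    intro θ
    ext i j
    have hA : Summable fun k : ℤ => (autocorr P x k i j : ℂ) * Complex.exp (-(Complex.I * θ * k)) :=
      Summable.of_norm (by
        simpa only [norm_mul, norm_exp_neg_I_mul, mul_one, Complex.norm_real,
          Real.norm_eq_abs] using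
          hR.summable_entry i j)
    have hE := hasSum_ite_eq (0 : ℤ) (M * (1 : Matrix (Fin p) (Fin p) ℂ) i j)
    have hsub := (hE.sub hA.hasSum).tsum_eq
    simp only [symbol, psdm, Matrix.of_apply, Matrix.sub_apply, Matrix.smul_apply, smul_eq_mul]
    rw [← hsub]
    refine tsum_congr fun k => ?_
    simp only [D, Matrix.sub_apply]
    push_cast
    rw [sub_mul]
    congr 1
    split_ifs with h0
    · by_cases hij : i = j <;> simp [h0, Matrix.one_apply, hij]
    · simp
  have h := toeplitz_nonneg hD (fun θ hθ v => by
    rw [hsymb, Matrix.sub_mulVec, dotProduct_sub, Matrix.smul_mulVec, Matrix.one_mulVec,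
      dotProduct_smul]
    have h1 := norm_star_dotProduct_mulVec_le (psdm P x θ) (WithLp.toLp 2 v)
    have h2 := norm_psdm_le hp hM hθ (isHermitian_psdm hsym θ)
    have h3 : star v ⬝ᵥ v = ((‖(WithLp.toLp 2 v : EuclideanSpace ℂ (Fin p))‖ ^ 2 : ℝ) : ℂ) := by
      rw [EuclideanSpace.norm_sq_eq, dotProduct]
      push_cast
      refine Finset.sum_congr rfl fun i _ => ?_
      simp [← Complex.conj_mul']
    have h4 := (Complex.re_le_norm _).trans h1
    rw [h3]
    simp only [Complex.sub_re, smul_eq_mul, ← Complex.ofReal_mul, Complex.ofReal_re]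
    have := mul_le_mul_of_nonneg_right h2 (sq_nonneg ‖(WithLp.toLp 2 v : EuclideanSpace ℂ (Fin p))‖)
    linarith) τ c u
  have hsplit : ∑ a, ∑ b, u a * u b * D (τ a - τ b) (c a) (c b)
      = M * ∑ a, u a ^ 2 - ∑ a, ∑ b, u a * u b * autocorr P x (τ a - τ b) (c a) (c b) := by
    rw [Finset.mul_sum, ← Finset.sum_sub_distrib]
    refine Finset.sum_congr rfl fun a _ => ?_
    simp only [D, Matrix.sub_apply, mul_sub, Finset.sum_sub_distrib]
    congr 1
    -- Distinct indices with equal times have distinct coordinates, by injectivity, so the identity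
    -- block contributes only on the diagonal.
    rw [Finset.sum_eq_single a]
    · simp; ring
    · intro b _ hb
      split_ifs with h0
      · have : c a ≠ c b := fun hc => hb (hinj (Prod.ext (sub_eq_zero.1 h0).symm hc.symm))
        simp [this]
      · simp
    · simp
  linarith

end DDAG

/-! ### Closed spans of shifted sequences, and Gaussian limits in L². -/

namespace DDAG

section ShiftSpan

variable {E ι : Type*} [NormedAddCommGroup E] [NormedSpace ℝ E]

/-- The closure, for pointwise convergence, of the linear combinations of time shifts of the
sequences `ε i`. -/
def shiftSpan (ε : ι → ℤ → E) : Submodule ℝ (ℤ → E) :=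
  (Submodule.span ℝ {F | ∃ i l, F = fun k => ε i (k - l)}).topologicalClosure

lemma isClosed_shiftSpan (ε : ι → ℤ → E) : IsClosed (shiftSpan ε : Set (ℤ → E)) :=
  Submodule.isClosed_topologicalClosure _

lemma mem_shiftSpan (ε : ι → ℤ → E) (i : ι) : ε i ∈ shiftSpan ε :=
  Submodule.le_topologicalClosure _ (Submodule.subset_span ⟨i, 0, by simp⟩)

lemma shiftSpan_le {ε : ι → ℤ → E} {S : Submodule ℝ (ℤ → E)} (hS : IsClosed (S : Set (ℤ → E)))
    (h : ∀ i l, (fun k => ε i (k - l)) ∈ S) : shiftSpan ε ≤ S :=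
  Submodule.topologicalClosure_minimal _ (Submodule.span_le.2 fun _ ⟨i, l, hF⟩ => hF ▸ h i l) hS

lemma shift_mem_shiftSpan {ε : ι → ℤ → E} {F : ℤ → E} (hF : F ∈ shiftSpan ε) (m : ℤ) :
    (fun k => F (k - m)) ∈ shiftSpan ε := by
  let S : (ℤ → E) →L[ℝ] (ℤ → E) :=
    ContinuousLinearMap.pi fun k => ContinuousLinearMap.proj (R := ℝ) (φ := fun _ : ℤ => E) (k - m)
  have : shiftSpan ε ≤ (shiftSpan ε).comap S.toLinearMap := by
    refine shiftSpan_le ((isClosed_shiftSpan ε).preimage S.continuous) fun i l => ?_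
    refine Submodule.le_topologicalClosure _ (Submodule.subset_span ⟨i, m + l, ?_⟩)
    ext k
    simp [S, sub_sub]
  exact this hF

lemma eval_mem_of_mem_shiftSpan {ε : ι → ℤ → E} {F : ℤ → E} (hF : F ∈ shiftSpan ε) (k : ℤ) :
    F k ∈ (Submodule.span ℝ (Set.range fun a : ι × ℤ => ε a.1 a.2)).topologicalClosure := by
  let π := ContinuousLinearMap.proj (R := ℝ) (φ := fun _ : ℤ => E) k
  have : shiftSpan ε ≤ ((Submodule.span ℝ (Set.range fun a : ι × ℤ => ε a.1 a.2)).topologicalClosure).comap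
      π.toLinearMap := by
    refine shiftSpan_le ((Submodule.isClosed_topologicalClosure _).preimage π.continuous)
      fun i l => ?_
    exact Submodule.le_topologicalClosure _ (Submodule.subset_span ⟨(i, k - l), rfl⟩)
  exact this hF

end ShiftSpan

/-- Shift invariance of inner products is a closed linear condition in each sequence separately, so
it extends from the generators one argument at a time. -/
lemma inner_shift_eq_of_mem_shiftSpan {E ι : Type*} [NormedAddCommGroup E] [InnerProductSpace ℝ E]
    {ε : ι → ℤ → E}
    (hε : ∀ i j k l m, inner ℝ (ε i (k + m)) (ε j (l + m)) = inner ℝ (ε i k) (ε j l))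
    {F G : ℤ → E} (hF : F ∈ shiftSpan ε) (hG : G ∈ shiftSpan ε) (k l m : ℤ) :
    inner ℝ (F (k + m)) (G (l + m)) = inner ℝ (F k) (G l) := by
  let π : ℤ → (ℤ → E) →L[ℝ] E := fun k => ContinuousLinearMap.proj (R := ℝ) (φ := fun _ : ℤ => E) k
  let Λ : (ℤ → E) → ℤ → ℤ → (ℤ → E) →L[ℝ] ℝ := fun H a b =>
    (innerSL ℝ (H (a + m))).comp (π (b + m)) - (innerSL ℝ (H a)).comp (π b)
  have h1 : ∀ i l' a b, ∀ H ∈ shiftSpan ε, Λ (fun k => ε i (k - l')) a b H = 0 := by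
    intro i l' a b H hH
    have : shiftSpan ε ≤ LinearMap.ker (Λ (fun k => ε i (k - l')) a b).toLinearMap := by
      refine shiftSpan_le (ContinuousLinearMap.isClosed_ker _) fun j l'' => ?_
      have := hε i j (a - l') (b - l'') m
      simp only [LinearMap.mem_ker, Λ, π, ContinuousLinearMap.coe_coe, sub_apply,
        ContinuousLinearMap.comp_apply, ContinuousLinearMap.proj_apply, innerSL_apply_apply]
      rw [sub_eq_zero, ← this]
      congr 2 <;> ring
    exact this hH
  have : shiftSpan ε ≤ LinearMap.ker (Λ F k l).toLinearMap := by
    refine shiftSpan_le (ContinuousLinearMap.isClosed_ker _) fun j l'' => ?_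
    have := h1 j l'' l k F hF
    simp only [LinearMap.mem_ker, Λ, π, ContinuousLinearMap.coe_coe, sub_apply,
      ContinuousLinearMap.comp_apply, ContinuousLinearMap.proj_apply, innerSL_apply_apply] at this ⊢
    rw [real_inner_comm, real_inner_comm _ (F k)]
    exact this
  have := this hG
  simpa [Λ, π, sub_eq_zero] using this

variable {Ω : Type*} [MeasurableSpace Ω] {P : Measure Ω}

lemma integral_norm_le_norm_Lp [IsProbabilityMeasure P] (Y : Lp ℝ 2 P) :
    ∫ ω, ‖Y ω‖ ∂P ≤ ‖Y‖ := by
  rw [Lp.norm_def, integral_norm_eq_lintegral_enorm (Lp.aestronglyMeasurable Y),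
    ← eLpNorm_one_eq_lintegral_enorm]
  exact ENNReal.toReal_mono (Lp.eLpNorm_ne_top Y)
    (eLpNorm_le_eLpNorm_of_exponent_le (by norm_num) (Lp.aestronglyMeasurable Y))

/-- The map is Lipschitz with constant |t|, because |e^{ia} - e^{ib}| ≤ |a - b| and the L¹ norm is
at most the L² norm. Characteristic functions therefore pass to mean-square limits. -/
lemma continuous_integral_cexp [IsProbabilityMeasure P] (t : ℝ) :
    Continuous fun Y : Lp ℝ 2 P => ∫ ω, Complex.exp (t * Y ω * Complex.I) ∂P := by
  have hint : ∀ Y : Lp ℝ 2 P, Integrable (fun ω => Complex.exp (t * Y ω * Complex.I)) P := by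
    intro Y
    refine Integrable.of_bound (C := 1) ?_ (ae_of_all _ fun ω => ?_)
    · have := (Lp.aestronglyMeasurable Y).aemeasurable
      exact AEMeasurable.aestronglyMeasurable (by fun_prop)
    · rw [← Complex.ofReal_mul, Complex.norm_exp_ofReal_mul_I]
  refine (LipschitzWith.of_dist_le_mul (K := ‖t‖₊) fun Y Z => ?_).continuous
  rw [dist_eq_norm, dist_eq_norm, ← integral_sub (hint Y) (hint Z), coe_nnnorm]
  have hb : ∀ a b : ℝ, ‖Complex.exp (t * a * Complex.I) - Complex.exp (t * b * Complex.I)‖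
      ≤ ‖t‖ * ‖a - b‖ := by
    intro a b
    have h1 : Complex.exp (t * a * Complex.I) - Complex.exp (t * b * Complex.I)
        = Complex.exp ((t * b : ℝ) * Complex.I) * (Complex.exp (Complex.I * (t * (a - b) : ℝ)) - 1) := by
      rw [mul_sub, ← Complex.exp_add, mul_one]
      congr 2 <;> push_cast <;> ring
    rw [h1, norm_mul, Complex.norm_exp_ofReal_mul_I, one_mul, ← norm_mul]
    exact Real.norm_exp_I_mul_ofReal_sub_one_le
  calc _ ≤ ∫ ω, ‖t‖ * ‖(Y - Z : Lp ℝ 2 P) ω‖ ∂P := by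
        refine norm_integral_le_of_norm_le ?_ ?_
        · exact ((Lp.memLp (Y - Z)).integrable (by norm_num)).norm.const_mul _
        · filter_upwards [Lp.coeFn_sub Y Z] with ω hω
          rw [hω, Pi.sub_apply]
          exact hb _ _
    _ ≤ _ := by
        rw [integral_const_mul]
        exact mul_le_mul_of_nonneg_left (integral_norm_le_norm_Lp _) (norm_nonneg _)

/-- Centred Gaussianity passes to limits in mean square. -/
lemma map_eq_gaussianReal_of_mem_closure [IsProbabilityMeasure P] {S : Set (Lp ℝ 2 P)}
    (hS : ∀ Y ∈ S, P.map Y = gaussianReal 0 (‖Y‖ ^ 2).toNNReal) {Y : Lp ℝ 2 P}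
    (hY : Y ∈ closure S) : P.map Y = gaussianReal 0 (‖Y‖ ^ 2).toNNReal := by
  have hchar : ∀ (Z : Lp ℝ 2 P) (t : ℝ), charFun (P.map Z) t
      = ∫ ω, Complex.exp (t * Z ω * Complex.I) ∂P := fun Z t => by
    rw [charFun_apply_real, integral_map (Lp.aestronglyMeasurable Z).aemeasurable
      (by fun_prop)]
  have hg : ∀ (Z : Lp ℝ 2 P) (t : ℝ), charFun (gaussianReal 0 (‖Z‖ ^ 2).toNNReal) t
      = Complex.exp (-((‖Z‖ ^ 2 * t ^ 2 / 2 : ℝ) : ℂ)) := fun Z t => by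
    rw [charFun_gaussianReal, Real.coe_toNNReal _ (sq_nonneg _)]
    congr 1; push_cast; ring
  have := Measure.isProbabilityMeasure_map (μ := P) (Lp.aestronglyMeasurable Y).aemeasurable
  refine Measure.ext_of_charFun ?_
  ext t
  rw [hchar, hg]
  -- Both sides of the Gaussian characteristic function identity are continuous on L², the variance
  -- being ‖Z‖².
  have hcl : IsClosed {Z : Lp ℝ 2 P | ∫ ω, Complex.exp (t * Z ω * Complex.I) ∂P
      = Complex.exp (-((‖Z‖ ^ 2 * t ^ 2 / 2 : ℝ) : ℂ))} :=
    isClosed_eq (continuous_integral_cexp t) (by fun_prop)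
  refine closure_minimal (fun Z hZ => ?_) hcl hY
  rw [Set.mem_ofPred_eq, ← hchar, ← hg, hS Z hZ]

lemma map_eq_gaussianReal_norm [IsProbabilityMeasure P] (Y : Lp ℝ 2 P)
    (h : HasGaussianLaw Y P) (h0 : ∫ ω, Y ω ∂P = 0) :
    P.map Y = gaussianReal 0 (‖Y‖ ^ 2).toNNReal := by
  rw [h.map_eq_gaussianReal, h0, variance_eq_integral h.aemeasurable, h0,
    ← real_inner_self_eq_norm_sq, L2.inner_def]
  congr 2
  refine integral_congr_ae (ae_of_all _ fun ω => ?_)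
  simp [sq]

lemma inner_toLp_eq_integral {f g : Ω → ℝ} {F G : Lp ℝ 2 P} (hF : F =ᵐ[P] f) (hG : G =ᵐ[P] g) :
    inner ℝ F G = ∫ ω, f ω * g ω ∂P := by
  rw [L2.inner_def]
  refine integral_congr_ae ?_
  filter_upwards [hF, hG] with ω h1 h2
  simp [h1, h2, mul_comm]

end DDAG

/-! ### Gaussianity and stationarity of the states. -/

namespace DDAG

variable {Ω : Type*} [MeasurableSpace Ω] {P : Measure Ω}

lemma coeFn_sum_smul {β : Type*} (s : Finset β) (c : β → ℝ) {F : β → Lp ℝ 2 P} {f : β → Ω → ℝ}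
    (hF : ∀ b, F b =ᵐ[P] f b) :
    (∑ b ∈ s, c b • F b : Lp ℝ 2 P) =ᵐ[P] fun ω => ∑ b ∈ s, c b * f b ω := by
  have h1 : ∀ b ∈ s, ∀ᵐ ω ∂P, (c b • F b : Lp ℝ 2 P) ω = c b * f b ω := by
    intro b _
    filter_upwards [Lp.coeFn_smul (c b) (F b), hF b] with ω h1 h2
    rw [h1, Pi.smul_apply, h2, smul_eq_mul]
  filter_upwards [(Finset.eventually_all s).2 h1, Lp.coeFn_fun_finsetSum s fun b => c b • F b]
    with ω h2 h3
  rw [h3]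
  exact Finset.sum_congr rfl h2

/-- The real process `f` has a version in the closed span of the shifts of `ε`. -/
def InShiftSpan {ι : Type*} (P : Measure Ω) (ε : ι → ℤ → Lp ℝ 2 P) (f : ℤ → Ω → ℝ) : Prop :=
  ∃ F ∈ shiftSpan ε, ∀ k, F k =ᵐ[P] f k

namespace InShiftSpan

variable {ι : Type*} {ε : ι → ℤ → Lp ℝ 2 P} {f g : ℤ → Ω → ℝ}

lemma memLp (hf : InShiftSpan P ε f) (k : ℤ) : MemLp (f k) 2 P := by
  obtain ⟨F, -, h⟩ := hf
  exact (Lp.memLp (F k)).ae_eq (h k)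

lemma zero : InShiftSpan P ε fun _ _ => 0 :=
  ⟨0, Submodule.zero_mem _, fun _ => Lp.coeFn_zero _ _ _⟩

lemma add (hf : InShiftSpan P ε f) (hg : InShiftSpan P ε g) :
    InShiftSpan P ε fun k ω => f k ω + g k ω := by
  obtain ⟨F, hF, h⟩ := hf
  obtain ⟨G, hG, h'⟩ := hg
  refine ⟨F + G, Submodule.add_mem _ hF hG, fun k => ?_⟩
  filter_upwards [h k, h' k, Lp.coeFn_add (F k) (G k)] with ω h1 h2 h3
  rw [Pi.add_apply, h3, Pi.add_apply, h1, h2]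

lemma const_mul (c : ℝ) (hf : InShiftSpan P ε f) : InShiftSpan P ε fun k ω => c * f k ω := by
  obtain ⟨F, hF, h⟩ := hf
  refine ⟨c • F, Submodule.smul_mem _ _ hF, fun k => ?_⟩
  filter_upwards [h k, Lp.coeFn_smul c (F k)] with ω h1 h2
  rw [Pi.smul_apply, h2, Pi.smul_apply, h1, smul_eq_mul]

lemma shift (m : ℤ) (hf : InShiftSpan P ε f) : InShiftSpan P ε fun k => f (k - m) := by
  obtain ⟨F, hF, h⟩ := hf
  exact ⟨_, shift_mem_shiftSpan hF m, fun k => h (k - m)⟩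

lemma sum {β : Type*} {s : Finset β} {f : β → ℤ → Ω → ℝ} (hf : ∀ b ∈ s, InShiftSpan P ε (f b)) :
    InShiftSpan P ε fun k ω => ∑ b ∈ s, f b k ω := by
  classical
  induction s using Finset.induction_on with
  | empty => simpa using zero
  | insert b s hb ih =>
    simp_rw [Finset.sum_insert hb]
    exact (hf b (by simp)).add (ih fun b' hb' => hf b' (by simp [hb']))

lemma of_tendsto {f : ℤ → Ω → ℝ} {g : ℕ → ℤ → Ω → ℝ} (hg : ∀ K, InShiftSpan P ε (g K))
    (hf : ∀ k, AEStronglyMeasurable (f k) P)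
    (h : ∀ k, Tendsto (fun K => eLpNorm (fun ω => f k ω - g K k ω) 2 P) atTop (𝓝 0)) :
    InShiftSpan P ε f := by
  have hf2 : ∀ k, MemLp (f k) 2 P := fun k => by
    -- Square integrability is not assumed of the limit: it follows from being at L² distance less
    -- than 1 from some approximant.
    obtain ⟨K, hK⟩ := ((h k).eventually_lt_const (zero_lt_one)).exists
    have h1 : MemLp (fun ω => f k ω - g K k ω) 2 P :=
      ⟨(hf k).sub ((hg K).memLp k).1, hK.trans ENNReal.one_lt_top⟩
    have := h1.add ((hg K).memLp k)
    refine this.ae_eq (ae_of_all _ fun ω => ?_)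
    simp
  choose G hG hGg using hg
  refine ⟨fun k => (hf2 k).toLp, ?_, fun k => (hf2 k).coeFn_toLp⟩
  refine (isClosed_shiftSpan ε).mem_of_tendsto (f := G) (b := atTop) ?_
    (Eventually.of_forall fun K => hG K)
  rw [tendsto_pi_nhds]
  intro k
  rw [tendsto_iff_edist_tendsto_0]
  refine (h k).congr fun K => ?_
  rw [edist_comm, Lp.edist_def]
  refine eLpNorm_congr_ae ?_
  filter_upwards [hGg K k, (hf2 k).coeFn_toLp] with ω h1 h2
  simp [h1, h2]

end InShiftSpan

variable {p : ℕ} {G : Digraph (Fin p)} {h : Fin p → Fin p → ℤ → ℝ} {e x : ℤ → Ω → Fin p → ℝ}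

lemma IsAcyclic.wellFounded (hG : IsAcyclic G) : WellFounded G.Adj := by
  have : Std.Irrefl (Relation.TransGen G.Adj) := ⟨hG⟩
  have : IsTrans (Fin p) (Relation.TransGen G.Adj) := ⟨fun _ _ _ => Relation.TransGen.trans⟩
  exact Subrelation.wf (fun h => Relation.TransGen.single h)
    (Finite.wellFounded_of_trans_of_irrefl (Relation.TransGen G.Adj))

lemma IsExogenousNoise.isGaussianProcess_coord (he : IsExogenousNoise P e) :
    IsGaussianProcess (fun (a : Fin p × ℤ) ω => e a.2 ω a.1) P :=
  he.gaussian.of_isGaussianProcess fun a => ⟨{a.2},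
    (ContinuousLinearMap.proj (R := ℝ) (φ := fun _ : Fin p => ℝ) a.1).comp
      (ContinuousLinearMap.proj (R := ℝ) (φ := fun _ : ({a.2} : Finset ℤ) => Fin p → ℝ)
        ⟨a.2, by simp⟩), fun ω => by simp⟩

lemma IsExogenousNoise.memLp (he : IsExogenousNoise P e) (i : Fin p) (k : ℤ) :
    MemLp (fun ω => e k ω i) 2 P :=
  (he.isGaussianProcess_coord.hasGaussianLaw_eval (i, k)).memLp_two

/-- The coordinates of the noise as elements of `L²`. -/
noncomputable def IsExogenousNoise.lp (he : IsExogenousNoise P e) (i : Fin p) (k : ℤ) : Lp ℝ 2 P :=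
  (he.memLp i k).toLp

/-- Induction on the edge relation, well-founded because the graph is finite and acyclic: the span
is closed under shifts, linear combinations and mean-square limits, so it contains a node's state
once it contains those of its parents. -/
lemma IsLDS.inShiftSpan (hx : IsLDS P G h e x) (i : Fin p) :
    InShiftSpan P hx.noise.lp fun k ω => x k ω i := by
  induction i using hx.acyclic.wellFounded.induction with
  | _ i ih =>
    have he : InShiftSpan P hx.noise.lp fun k ω => e k ω i :=
      ⟨_, mem_shiftSpan _ i, fun k => (hx.noise.memLp i k).coeFn_toLp⟩
    refine InShiftSpan.of_tendsto (fun K => InShiftSpan.add (InShiftSpan.sum fun j _ =>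
      InShiftSpan.sum fun m _ => ?_) he) (fun k => ?_) (fun k => hx.dynamics k i)
    · by_cases hj : G.Adj j i
      · exact ((ih j hj).shift m).const_mul _
      · have : h i j = 0 := by
          by_contra h0
          exact hj ((hx.filter_ne_zero_iff i j).1 h0)
        simpa [this] using InShiftSpan.zero
    · exact ((measurable_pi_apply i).comp (hx.measurable_state k)).aestronglyMeasurable

lemma IsExogenousNoise.inner_lp (he : IsExogenousNoise P e) (i j : Fin p) (k l m : ℤ) :
    inner ℝ (he.lp i (k + m)) (he.lp j (l + m)) = inner ℝ (he.lp i k) (he.lp j l) := by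
  have h0 : ∀ k l, inner ℝ (he.lp i k) (he.lp j l) = ∫ ω, e k ω i * e l ω j ∂P := fun k l =>
    inner_toLp_eq_integral (he.memLp i k).coeFn_toLp (he.memLp j l).coeFn_toLp
  rw [h0, h0]
  have h1 := he.stationary (k - l) (l + m) i j
  have h2 := he.stationary (k - l) l i j
  rw [show k - l + (l + m) = k + m by ring] at h1
  rw [show k - l + l = k by ring] at h2
  rw [h1, h2]

lemma IsExogenousNoise.map_eq_gaussianReal [IsProbabilityMeasure P] (he : IsExogenousNoise P e)
    {Y : Lp ℝ 2 P} (hY : Y ∈ (Submodule.span ℝ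
      (Set.range fun a : Fin p × ℤ => he.lp a.1 a.2)).topologicalClosure) :
    P.map Y = gaussianReal 0 (‖Y‖ ^ 2).toNNReal := by
  refine map_eq_gaussianReal_of_mem_closure (fun Z hZ => ?_) hY
  obtain ⟨c, rfl⟩ := Finsupp.mem_span_range_iff_exists_finsupp.1 hZ
  set Z := c.sum fun a r => r • he.lp a.1 a.2
  have hZe : (fun ω => ∑ a ∈ c.support, c a • e a.2 ω a.1) =ᵐ[P] Z :=
    (coeFn_sum_smul c.support c fun a => (he.memLp a.1 a.2).coeFn_toLp).symm
  have hG := ((he.isGaussianProcess_coord.smul c).hasGaussianLaw_fun_sum (I := c.support)).congr hZe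
  refine map_eq_gaussianReal_norm Z hG ?_
  rw [← integral_congr_ae hZe, integral_finsetSum]
  · simp [integral_const_mul, he.zero_mean]
  · exact fun a _ => ((he.memLp a.1 a.2).integrable (by norm_num)).smul (c a)

section Moments

variable (hx : IsLDS P G h e x)
include hx

lemma IsLDS.memLp (i : Fin p) (k : ℤ) : MemLp (fun ω => x k ω i) 2 P :=
  (hx.inShiftSpan i).memLp k

lemma IsLDS.integral_mul_eq_autocorr (i j : Fin p) (k l : ℤ) :
    ∫ ω, x k ω i * x l ω j ∂P = autocorr P x (k - l) i j := by
  obtain ⟨F, hF, hFx⟩ := hx.inShiftSpan i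
  obtain ⟨F', hF', hFx'⟩ := hx.inShiftSpan j
  have := inner_shift_eq_of_mem_shiftSpan hx.noise.inner_lp hF hF' (k - l) 0 l
  rw [inner_toLp_eq_integral (hFx _) (hFx' _), inner_toLp_eq_integral (hFx _) (hFx' _)] at this
  simpa [autocorr] using this

lemma IsLDS.autocorr_neg (k : ℤ) (i j : Fin p) :
    autocorr P x (-k) i j = autocorr P x k j i := by
  have h1 := hx.integral_mul_eq_autocorr i j 0 k
  have h2 := hx.integral_mul_eq_autocorr j i k 0
  rw [zero_sub] at h1
  rw [sub_zero] at h2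
  rw [← h1, ← h2]
  exact integral_congr_ae (ae_of_all _ fun ω => mul_comm _ _)

/-- The combination lies in the closed span of the noise variables, all of whose elements are
centred Gaussian. Joint Gaussianity of the states follows, since it is tested on linear functionals.
-/
lemma IsLDS.map_linearCombination [IsProbabilityMeasure P] {α : Type*} [Fintype α] (τ : α → ℤ)
    (c : α → Fin p) (u : α → ℝ) :
    ∃ v, P.map (fun ω => ∑ a, u a * x (τ a) ω (c a)) = gaussianReal 0 v := by
  choose F hF hFx using hx.inShiftSpan
  let Y : Lp ℝ 2 P := ∑ a, u a • F (c a) (τ a)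
  have hY : (fun ω => ∑ a, u a * x (τ a) ω (c a)) =ᵐ[P] Y :=
    (coeFn_sum_smul Finset.univ u fun a => hFx (c a) (τ a)).symm
  rw [Measure.map_congr hY]
  exact ⟨_, hx.noise.map_eq_gaussianReal (Submodule.sum_mem _ fun a _ =>
    Submodule.smul_mem _ _ (eval_mem_of_mem_shiftSpan (hF _) _))⟩

lemma IsLDS.integral_eq_zero [IsProbabilityMeasure P] (k : ℤ) (i : Fin p) :
    ∫ ω, x k ω i ∂P = 0 := by
  obtain ⟨v, hv⟩ := hx.map_linearCombination (fun _ : Unit => k) (fun _ => i) (fun _ => 1)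
  simp only [Finset.univ_unique, Finset.sum_const, Finset.card_singleton, one_mul, one_smul] at hv
  have h1 := integral_id_gaussianReal (μ := 0) (v := v)
  rwa [← hv, integral_map (hx.memLp i k).1.aemeasurable (by fun_prop)] at h1

lemma IsLDS.hasGaussianLaw [IsProbabilityMeasure P] {α : Type*} [Fintype α] (τ : α → ℤ)
    (c : α → Fin p) : HasGaussianLaw (fun ω a => x (τ a) ω (c a)) P := by
  classical
  refine ⟨isGaussian_of_map_eq_gaussianReal fun L => ?_⟩
  have hm : Measurable fun ω a => x (τ a) ω (c a) := by
    refine measurable_pi_lambda _ fun a => ?_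
    exact (measurable_pi_apply _).comp (hx.measurable_state _)
  rw [Measure.map_map (by fun_prop) hm]
  obtain ⟨v, hv⟩ := hx.map_linearCombination τ c fun a => L (Pi.single a 1)
  refine ⟨0, v, ?_⟩
  rw [← hv]
  congr 1
  ext ω
  simp only [Function.comp_apply]
  conv_lhs => rw [← Finset.univ_sum_single (fun a => x (τ a) ω (c a)), map_sum]
  refine Finset.sum_congr rfl fun a _ => ?_
  rw [mul_comm, ← smul_eq_mul, ← map_smul, ← Pi.single_smul', smul_eq_mul, mul_one]

end Moments

end DDAG

/-! ### The two sampling schemes. -/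

namespace DDAG

variable {Ω Ω' : Type*} [MeasurableSpace Ω] [MeasurableSpace Ω'] {P : Measure Ω} {P' : Measure Ω'}
  {p n N : ℕ} {G : Digraph (Fin p)} {h : Fin p → Fin p → ℤ → ℝ} {e x : ℤ → Ω → Fin p → ℝ}

/-- Second-order properties shared by both sampling schemes: the recorded samples are centred
and jointly Gaussian, each trajectory has the autocorrelation of `x`, and the joint covariance is
bounded by `M`. -/
structure IsGaussianSample (P : Measure Ω) (x : ℤ → Ω → Fin p → ℝ) (M : ℝ) (P' : Measure Ω')
    (y : Fin n → Ω' → Fin N → Fin p → ℝ) : Prop where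
  hasGaussianLaw : HasGaussianLaw (fun ω (a : Fin n × Fin N × Fin p) => y a.1 ω a.2.1 a.2.2) P'
  integral_eq_zero : ∀ r t i, ∫ ω, y r ω t i ∂P' = 0
  integral_mul : ∀ r (s t : Fin N) i j,
    ∫ ω, y r ω s i * y r ω t j ∂P' = autocorr P x ((s : ℤ) - (t : ℤ)) i j
  integral_sq_le : ∀ u : Fin n × Fin N × Fin p → ℝ,
    ∫ ω, (∑ a, u a * y a.1 ω a.2.1 a.2.2) ^ 2 ∂P' ≤ M * ∑ a, u a ^ 2

lemma IsLDS.integral_sq_linearCombination_le (hx : IsLDS P G h e x) {M C ρ : ℝ}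
    (hM : PSDMBound P x M) (hR : AutocorrDecay P x C ρ) {α : Type*} [Fintype α] {τ : α → ℤ}
    {c : α → Fin p} (hinj : Function.Injective fun a => (τ a, c a)) (u : α → ℝ) :
    ∫ ω, (∑ a, u a * x (τ a) ω (c a)) ^ 2 ∂P ≤ M * ∑ a, u a ^ 2 := by
  refine le_of_eq_of_le ?_ (autocorr_form_le hM hR hx.autocorr_neg hinj u)
  have hI : ∀ a b, Integrable (fun ω => u a * u b * (x (τ a) ω (c a) * x (τ b) ω (c b))) P :=
    fun a b => ((hx.memLp (c a) (τ a)).integrable_mul (hx.memLp (c b) (τ b))).const_mul _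
  have hsq : ∀ ω, (∑ a, u a * x (τ a) ω (c a)) ^ 2
      = ∑ a, ∑ b, u a * u b * (x (τ a) ω (c a) * x (τ b) ω (c b)) := fun ω => by
    rw [sq, Finset.sum_mul_sum]
    exact Finset.sum_congr rfl fun a _ => Finset.sum_congr rfl fun b _ => by ring
  simp_rw [hsq]
  rw [integral_finsetSum _ fun a _ => integrable_finsetSum _ fun b _ => hI a b]
  refine Finset.sum_congr rfl fun a _ => ?_
  rw [integral_finsetSum _ fun b _ => hI a b]
  refine Finset.sum_congr rfl fun b _ => ?_
  rw [integral_const_mul, hx.integral_mul_eq_autocorr]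

lemma hasGaussianLaw_flatten {y : Fin n → Ω' → Fin N → Fin p → ℝ}
    (hy : HasGaussianLaw (fun ω r => y r ω) P') :
    HasGaussianLaw (fun ω (a : Fin n × Fin N × Fin p) => y a.1 ω a.2.1 a.2.2) P' :=
  hy.map_fun (ContinuousLinearMap.pi fun a : Fin n × Fin N × Fin p =>
    (ContinuousLinearMap.proj (R := ℝ) (φ := fun _ : Fin p => ℝ) a.2.2).comp
      ((ContinuousLinearMap.proj (R := ℝ) (φ := fun _ : Fin N => Fin p → ℝ) a.2.1).comp
        (ContinuousLinearMap.proj (R := ℝ) (φ := fun _ : Fin n => Fin N → Fin p → ℝ) a.1)))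

lemma ContinuousSampling.isGaussianSample [IsProbabilityMeasure P] (hx : IsLDS P G h e x)
    {M C ρ : ℝ} (hM : PSDMBound P x M) (hR : AutocorrDecay P x C ρ)
    {y : Fin n → Ω' → Fin N → Fin p → ℝ} (hy : ContinuousSampling P x P' y) :
    IsGaussianSample P x M P' y := by
  let τ : Fin n × Fin N × Fin p → ℤ := fun a => (a.1 : ℤ) * N + a.2.1
  have hid : IdentDistrib (fun ω (a : Fin n × Fin N × Fin p) => y a.1 ω a.2.1 a.2.2)
      (fun ω a => x (τ a) ω a.2.2) P' P :=
    IdentDistrib.comp hy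
      (u := fun (z : Fin n → Fin N → Fin p → ℝ) (a : Fin n × Fin N × Fin p) => z a.1 a.2.1 a.2.2)
      (by fun_prop)
  refine ⟨?_, fun r t i => ?_, fun r s t i j => ?_, fun u => ?_⟩
  · have := hx.hasGaussianLaw τ fun a => a.2.2
    exact ⟨hid.map_eq ▸ this.isGaussian_map⟩
  · have := (hid.comp (u := fun z => z (r, t, i)) (by fun_prop)).integral_eq
    exact this.trans (hx.integral_eq_zero _ _)
  · have := (hid.comp (u := fun z => z (r, s, i) * z (r, t, j)) (by fun_prop)).integral_eq
    refine this.trans ((hx.integral_mul_eq_autocorr _ _ _ _).trans ?_)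
    congr 1
    simp [τ]
  · have := (hid.comp (u := fun z => (∑ a, u a * z a) ^ 2) (by fun_prop)).integral_eq
    refine this.trans_le (hx.integral_sq_linearCombination_le hM hR ?_ u)
    rintro ⟨r, t, i⟩ ⟨r', t', i'⟩ hab
    simp only [Prod.mk.injEq, τ] at hab
    obtain ⟨h1, rfl⟩ := hab
    have ht : (t : ℤ) < N := by exact_mod_cast t.2
    have ht' : (t' : ℤ) < N := by exact_mod_cast t'.2
    -- Uniqueness of division by N with remainder: distinct pairs (r, t) are distinct times, as the
    -- Toeplitz bound requires.
    have hr : (r : ℤ) = r' := by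
      have e1 := Int.ediv_emod_unique (a := (r : ℤ) * N + t) (b := N) (r := t) (q := r) (by omega)
      have e2 := Int.ediv_emod_unique (a := (r : ℤ) * N + t) (b := N) (r := t') (q := r') (by omega)
      have h1' := (e1.2 ⟨by ring, by omega, ht⟩).1
      have h2' := (e2.2 ⟨by rw [h1]; ring, by omega, ht'⟩).1
      omega
    rw [hr] at h1
    have e1 : r = r' := Fin.ext (by omega)
    have e2 : t = t' := Fin.ext (by omega)
    rw [e1, e2]

lemma RestartAndRecord.isGaussianSample [IsProbabilityMeasure P] [IsProbabilityMeasure P']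
    (hx : IsLDS P G h e x)
    {M C ρ : ℝ} (hM : PSDMBound P x M) (hR : AutocorrDecay P x C ρ)
    {y : Fin n → Ω' → Fin N → Fin p → ℝ} (hy : RestartAndRecord P x P' y) :
    IsGaussianSample P x M P' y := by
  have hyr : ∀ r, HasGaussianLaw (y r) P' := fun r => by
    have h1 := hx.hasGaussianLaw (fun a : Fin N × Fin p => (a.1 : ℤ)) fun a => a.2
    have h2 := h1.map_fun (ContinuousLinearMap.pi fun t : Fin N => ContinuousLinearMap.pi
      fun i : Fin p => ContinuousLinearMap.proj (R := ℝ) (φ := fun _ : Fin N × Fin p => ℝ) (t, i))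
    exact ⟨(hy.law r).map_eq ▸ h2.isGaussian_map⟩
  have hG := hasGaussianLaw_flatten (hy.indep.hasGaussianLaw hyr)
  have h0 : ∀ r t i, ∫ ω, y r ω t i ∂P' = 0 := fun r t i => by
    have := ((hy.law r).comp (u := fun z => z t i) (by fun_prop)).integral_eq
    exact this.trans (hx.integral_eq_zero _ _)
  have hL : ∀ r t i, MemLp (fun ω => y r ω t i) 2 P' := fun r t i => (hG.eval (r, t, i)).memLp_two
  refine ⟨hG, h0, fun r s t i j => ?_, fun u => ?_⟩
  · have := ((hy.law r).comp (u := fun z => z s i * z t j) (by fun_prop)).integral_eq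
    exact this.trans (hx.integral_mul_eq_autocorr _ _ _ _)
  -- The contributions of the individual trajectories are centred and independent, so their
  -- variances add and each is bounded separately.
  · let A : Fin n → Ω' → ℝ := fun r ω => ∑ b : Fin N × Fin p, u (r, b) * y r ω b.1 b.2
    have hA2 : ∀ r, MemLp (A r) 2 P' := fun r =>
      memLp_finsetSum _ fun b _ => (hL r b.1 b.2).const_mul _
    have hA0 : ∀ r, ∫ ω, A r ω ∂P' = 0 := fun r => by
      simp only [A]
      rw [integral_finsetSum _ fun b _ => ((hL r b.1 b.2).integrable (by norm_num)).const_mul _]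
      simp [integral_const_mul, h0]
    have hAV : ∀ r, ∫ ω, A r ω ^ 2 ∂P' ≤ M * ∑ b, u (r, b) ^ 2 := fun r => by
      have := ((hy.law r).comp (u := fun z => (∑ b : Fin N × Fin p, u (r, b) * z b.1 b.2) ^ 2)
        (by fun_prop)).integral_eq
      refine this.trans_le (hx.integral_sq_linearCombination_le hM hR (τ := fun b : Fin N × Fin p =>
        (b.1 : ℤ)) (c := fun b => b.2) ?_ fun b => u (r, b))
      rintro ⟨t, i⟩ ⟨t', i'⟩ hab
      simp only [Prod.mk.injEq] at hab
      exact Prod.ext (Fin.ext (by simpa using hab.1)) hab.2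
    have hind : iIndepFun A P' :=
      hy.indep.comp (fun r z => ∑ b : Fin N × Fin p, u (r, b) * z b.1 b.2) fun r => by fun_prop
    have hsum : ∀ ω, ∑ a : Fin n × Fin N × Fin p, u a * y a.1 ω a.2.1 a.2.2 = (∑ r, A r) ω :=
      fun ω => by rw [Fintype.sum_prod_type, Finset.sum_apply]
    have hv := IndepFun.variance_sum (s := Finset.univ) (fun r _ => hA2 r)
      (fun r _ s _ hrs => hind.indepFun hrs)
    have hvr : ∀ r, Var[A r; P'] = ∫ ω, A r ω ^ 2 ∂P' := fun r => by
      rw [variance_eq_integral (hA2 r).1.aemeasurable]; simp [hA0 r]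
    have hvs : Var[∑ r, A r; P'] = ∫ ω, (∑ r, A r) ω ^ 2 ∂P' := by
      have hm : ∫ ω, (∑ r, A r) ω ∂P' = 0 := by
        simp only [Finset.sum_apply]
        rw [integral_finsetSum _ fun r _ => (hA2 r).integrable (by norm_num)]
        simp [hA0]
      rw [variance_eq_integral (memLp_finsetSum' _ fun r _ => hA2 r).1.aemeasurable]
      simp only [hm, sub_zero]
    simp_rw [hsum]
    rw [← hvs, hv, Fintype.sum_prod_type, Finset.mul_sum]
    exact Finset.sum_le_sum fun r _ => (hvr r).trans_le (hAV r)

end DDAG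

/-! ### Concentration of the estimator's quadratic form at a fixed vector. -/

namespace DDAG

variable {Ω Ω' : Type*} [MeasurableSpace Ω] [MeasurableSpace Ω'] {P : Measure Ω} {P' : Measure Ω'}
  {p n N : ℕ} {x : ℤ → Ω → Fin p → ℝ}

/-- The weights of the samples of one trajectory in `v^* x^r(θ)`. -/
noncomputable def dftWeight (N : ℕ) (θ : ℝ) (v : Fin p → ℂ) (b : Fin N × Fin p) : ℂ :=
  star (v b.2) * ((1 / (Real.sqrt N : ℂ)) * Complex.exp (-(Complex.I * θ * ((b.1 : ℕ) : ℂ))))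

lemma star_dotProduct_dft (v : Fin p → ℂ) (θ : ℝ) (z : Fin N → Fin p → ℝ) :
    star v ⬝ᵥ dft z θ = ∑ b, dftWeight N θ v b * (z b.1 b.2 : ℂ) := by
  simp only [dotProduct, dft, Finset.mul_sum, Fintype.sum_prod_type, dftWeight, Pi.star_apply]
  rw [Finset.sum_comm]
  exact Finset.sum_congr rfl fun t _ => Finset.sum_congr rfl fun i _ => by ring

lemma inv_sqrt_mul_self (N : ℕ) : (1 / (Real.sqrt N : ℂ)) * (1 / (Real.sqrt N : ℂ)) = 1 / (N : ℂ) := by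
  rw [div_mul_div_comm, one_mul, ← Complex.ofReal_mul, Real.mul_self_sqrt (by positivity)]
  simp

lemma dftWeight_mul_star (θ : ℝ) (v : Fin p → ℂ) (b b' : Fin N × Fin p) :
    dftWeight N θ v b * star (dftWeight N θ v b') = (1 / (N : ℂ)) * (star (v b.2) *
      (Complex.exp (-(Complex.I * θ * (((b.1 : ℤ) - (b'.1 : ℤ) : ℤ) : ℂ))) * v b'.2)) := by
  have h1 : star (Complex.exp (-(Complex.I * θ * ((b'.1 : ℕ) : ℂ))))
      = Complex.exp (Complex.I * θ * ((b'.1 : ℕ) : ℂ)) := by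
    rw [Complex.star_def, ← Complex.exp_conj]; simp
  have h2 : star (1 / (Real.sqrt N : ℂ)) = 1 / (Real.sqrt N : ℂ) := by
    rw [Complex.star_def, map_div₀, map_one, Complex.conj_ofReal]
  have h3 : Complex.exp (-(Complex.I * θ * (((b.1 : ℤ) - (b'.1 : ℤ) : ℤ) : ℂ)))
      = Complex.exp (-(Complex.I * θ * ((b.1 : ℕ) : ℂ))) * Complex.exp (Complex.I * θ * ((b'.1 : ℕ) : ℂ)) := by
    rw [← Complex.exp_add]; congr 1; push_cast; ring
  rw [dftWeight, dftWeight, star_mul', star_mul', star_star, h1, h2, h3, ← inv_sqrt_mul_self]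
  ring

lemma sum_norm_sq_dftWeight (hN : N ≠ 0) (θ : ℝ) (v : EuclideanSpace ℂ (Fin p)) :
    ∑ b, ‖dftWeight N θ v b‖ ^ 2 = ‖v‖ ^ 2 := by
  have h1 : ∀ b : Fin N × Fin p, ‖dftWeight N θ v b‖ ^ 2 = 1 / (N : ℝ) * ‖v b.2‖ ^ 2 := fun b => by
    have h := norm_exp_neg_I_mul θ (b.1 : ℤ)
    rw [Int.cast_natCast] at h
    rw [dftWeight, norm_mul, norm_mul, h, norm_star, mul_one, mul_pow, norm_div, norm_one,
      Complex.norm_real, Real.norm_of_nonneg (Real.sqrt_nonneg _), div_pow,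
      Real.sq_sqrt (by positivity)]
    ring
  have hN' : (N : ℝ) ≠ 0 := by exact_mod_cast hN
  simp_rw [h1, Fintype.sum_prod_type, EuclideanSpace.norm_sq_eq, ← Finset.mul_sum]
  simp [hN']

lemma star_dotProduct_psdmEstimator (v : Fin p → ℂ) (θ : ℝ) (z : Fin n → Fin N → Fin p → ℝ) :
    star v ⬝ᵥ (psdmEstimator z θ).mulVec v
      = ((1 / (n : ℝ) * ∑ r, ‖star v ⬝ᵥ dft (z r) θ‖ ^ 2 : ℝ) : ℂ) := by
  rw [psdmEstimator, Matrix.smul_mulVec, dotProduct_smul, Matrix.sum_mulVec, dotProduct_sum]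
  push_cast
  rw [smul_eq_mul]
  congr 1
  refine Finset.sum_congr rfl fun r _ => ?_
  rw [Matrix.vecMulVec_mulVec, dotProduct_smul, op_smul_eq_mul,
    Matrix.star_dotProduct (dft (z r) θ) v, ← Complex.mul_conj', Complex.star_def]

lemma star_dotProduct_meanPsdm (v : Fin p → ℂ) (θ : ℝ) :
    star v ⬝ᵥ (meanPsdm P x N θ).mulVec v
      = ∑ b : Fin N × Fin p, ∑ b' : Fin N × Fin p,
        dftWeight N θ v b * star (dftWeight N θ v b')
          * (autocorr P x ((b.1 : ℤ) - (b'.1 : ℤ)) b.2 b'.2 : ℂ) := by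
  have h1 : ∀ i j, meanPsdm P x N θ i j = (1 / (N : ℂ)) * ∑ t : Fin N, ∑ t' : Fin N,
      Complex.exp (-(Complex.I * θ * (((t : ℤ) - (t' : ℤ) : ℤ) : ℂ)))
        * (autocorr P x ((t : ℤ) - (t' : ℤ)) i j : ℂ) := by
    intro i j
    rw [meanPsdm, Finset.sum_comm, Finset.sum_range]
    simp_rw [Finset.sum_range]
    simp [Matrix.sum_apply, psdmTerm]
  simp only [dftWeight_mul_star, dotProduct, Matrix.mulVec, h1, Fintype.sum_prod_type,
    Finset.mul_sum, Finset.sum_mul, Pi.star_apply]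
  conv_rhs => rw [Finset.sum_comm]
  refine Finset.sum_congr rfl fun i _ => ?_
  rw [Finset.sum_comm]
  refine Finset.sum_congr rfl fun t _ => ?_
  rw [Finset.sum_comm]
  exact Finset.sum_congr rfl fun t' _ => Finset.sum_congr rfl fun j _ => by ring

namespace IsGaussianSample

variable {M : ℝ} {y : Fin n → Ω' → Fin N → Fin p → ℝ}

/-- Real and imaginary parts of `v^* x^r(θ)`. -/
noncomputable def part (θ : ℝ) (v : Fin p → ℂ) (k : Fin 2) (b : Fin N × Fin p) : ℝ :=
  if k = 0 then (dftWeight N θ v b).re else (dftWeight N θ v b).im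

lemma sum_part_sq (θ : ℝ) (v : Fin p → ℂ) (b : Fin N × Fin p) :
    ∑ k, part θ v k b ^ 2 = ‖dftWeight N θ v b‖ ^ 2 := by
  rw [Complex.sq_norm, Complex.normSq_apply]
  simp [part, Fin.sum_univ_two, sq]

lemma norm_sq_star_dotProduct_dft (θ : ℝ) (v : Fin p → ℂ) (z : Fin N → Fin p → ℝ) :
    ‖star v ⬝ᵥ dft z θ‖ ^ 2 = ∑ k, (∑ b, part θ v k b * z b.1 b.2) ^ 2 := by
  rw [star_dotProduct_dft, Complex.sq_norm, Complex.normSq_apply]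
  simp [part, Fin.sum_univ_two, sq]

lemma memLp (hy : IsGaussianSample P x M P' y) (r : Fin n) (t : Fin N) (i : Fin p) :
    MemLp (fun ω => y r ω t i) 2 P' := (hy.hasGaussianLaw.eval (r, t, i)).memLp_two

/-- Identifies `meanPsdm` as the expected estimator, tested on v. Only correlations within one
trajectory enter, so the mean is the same for both schemes. -/
lemma integral_norm_sq (hy : IsGaussianSample P x M P' y) (θ : ℝ) (v : Fin p → ℂ) (r : Fin n) :
    ((∫ ω, ‖star v ⬝ᵥ dft (y r ω) θ‖ ^ 2 ∂P' : ℝ) : ℂ)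
      = star v ⬝ᵥ (meanPsdm P x N θ).mulVec v := by
  rw [← integral_complex_ofReal, star_dotProduct_meanPsdm]
  have h1 : ∀ ω, ((‖star v ⬝ᵥ dft (y r ω) θ‖ ^ 2 : ℝ) : ℂ)
      = ∑ b, ∑ b', dftWeight N θ v b * star (dftWeight N θ v b')
        * ((y r ω b.1 b.2 * y r ω b'.1 b'.2 : ℝ) : ℂ) := fun ω => by
    rw [Complex.ofReal_pow, ← Complex.mul_conj', star_dotProduct_dft, map_sum, Finset.sum_mul_sum]
    refine Finset.sum_congr rfl fun b _ => Finset.sum_congr rfl fun b' _ => ?_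
    rw [map_mul, Complex.conj_ofReal, Complex.star_def]
    push_cast; ring
  have hI : ∀ b b', Integrable (fun ω => dftWeight N θ v b * star (dftWeight N θ v b')
        * ((y r ω b.1 b.2 * y r ω b'.1 b'.2 : ℝ) : ℂ)) P' := fun b b' =>
    (((hy.memLp r b.1 b.2).integrable_mul (hy.memLp r b'.1 b'.2)).ofReal).const_mul _
  simp_rw [h1]
  rw [integral_finsetSum _ fun b _ => integrable_finsetSum _ fun b' _ => hI b b']
  refine Finset.sum_congr rfl fun b _ => ?_
  rw [integral_finsetSum _ fun b' _ => hI b b']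
  refine Finset.sum_congr rfl fun b' _ => ?_
  rw [integral_const_mul, integral_complex_ofReal, hy.integral_mul]

/-- The real and imaginary parts of v*x^r form a Gaussian vector of dimension 2n. Its covariance is
at most M because the weights have total squared modulus ‖v‖² = 1. -/
lemma measure_quadratic_ge_le [IsProbabilityMeasure P'] (hy : IsGaussianSample P x M P' y)
    (hM : 0 < M) (hn : n ≠ 0) (hN : N ≠ 0) (θ : ℝ) {v : EuclideanSpace ℂ (Fin p)} (hv : ‖v‖ = 1)
    {δ : ℝ} (hδ : 0 < δ) (hδM : δ ≤ 12 * M) :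
    P'.real {ω | δ / 2 ≤ ‖star (v : Fin p → ℂ) ⬝ᵥ
        (psdmEstimator (fun r => y r ω) θ - meanPsdm P x N θ).mulVec v‖}
      ≤ 2 * Real.exp (-(δ ^ 2 * n / (128 * M ^ 2))) := by
  have hn0 : (0 : ℝ) < n := by positivity
  have hw := sum_norm_sq_dftWeight (N := N) hN θ v
  rw [hv, one_pow] at hw
  let Z : Fin n × Fin 2 → Ω' → ℝ := fun a ω =>
    ∑ b : Fin N × Fin p, part θ v a.2 b * y a.1 ω b.1 b.2
  have hZG : HasGaussianLaw (fun ω => (Z · ω)) P' := by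
    let L : (Fin n × Fin N × Fin p → ℝ) →L[ℝ] (Fin n × Fin 2 → ℝ) :=
      ContinuousLinearMap.pi fun a => ∑ b : Fin N × Fin p, part θ v a.2 b •
        ContinuousLinearMap.proj (R := ℝ) (φ := fun _ : Fin n × Fin N × Fin p => ℝ) (a.1, b)
    have hL : (fun ω => (Z · ω)) = fun ω => L fun a => y a.1 ω a.2.1 a.2.2 := by
      ext ω a
      simp [Z, L]
    rw [hL]
    exact hy.hasGaussianLaw.map_fun L
  have hZ0 : ∀ a, ∫ ω, Z a ω ∂P' = 0 := fun a => by
    simp only [Z]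
    rw [integral_finsetSum _ fun b _ => ((hy.memLp a.1 b.1 b.2).integrable (by norm_num)).const_mul _]
    simp [integral_const_mul, hy.integral_eq_zero]
  have hV : ∀ c : Fin n × Fin 2 → ℝ, ∫ ω, (∑ a, c a * Z a ω) ^ 2 ∂P' ≤ M * ∑ a, c a ^ 2 := by
    intro c
    have h1 := hy.integral_sq_le fun d => ∑ k, c (d.1, k) * part θ v k d.2
    have h2 : ∀ ω, ∑ a, c a * Z a ω
        = ∑ d : Fin n × Fin N × Fin p, (∑ k, c (d.1, k) * part θ v k d.2) * y d.1 ω d.2.1 d.2.2 := by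
      intro ω
      rw [Fintype.sum_prod_type, Fintype.sum_prod_type]
      refine Finset.sum_congr rfl fun r _ => ?_
      simp only [Z, Finset.mul_sum, Finset.sum_mul]
      rw [Finset.sum_comm]
      exact Finset.sum_congr rfl fun b _ => Finset.sum_congr rfl fun k _ => by ring
    simp_rw [h2]
    refine h1.trans (mul_le_mul_of_nonneg_left ?_ hM.le)
    rw [Fintype.sum_prod_type, Fintype.sum_prod_type]
    refine Finset.sum_le_sum fun r _ => ?_
    calc ∑ b : Fin N × Fin p, (∑ k, c (r, k) * part θ v k b) ^ 2
        ≤ ∑ b : Fin N × Fin p, (∑ k, c (r, k) ^ 2) * ‖dftWeight N θ v b‖ ^ 2 := by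
          refine Finset.sum_le_sum fun b _ => ?_
          rw [← sum_part_sq]
          exact Finset.sum_mul_sq_le_sq_mul_sq _ _ _
      _ = ∑ k, c (r, k) ^ 2 := by rw [← Finset.mul_sum, hw, mul_one]
  have hZ2 : ∀ a, Integrable (fun ω => Z a ω ^ 2) P' := fun a => (hZG.eval a).memLp_two.integrable_sq
  have hsumZ : ∀ ω, ∑ a, Z a ω ^ 2 = ∑ r, ‖star (v : Fin p → ℂ) ⬝ᵥ dft (y r ω) θ‖ ^ 2 := fun ω => by
    rw [Fintype.sum_prod_type]
    exact Finset.sum_congr rfl fun r _ => (norm_sq_star_dotProduct_dft θ v (y r ω)).symm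
  have hr : ∀ r, ∑ k, ∫ ω, Z (r, k) ω ^ 2 ∂P' = ∫ ω, ‖star (v : Fin p → ℂ) ⬝ᵥ dft (y r ω) θ‖ ^ 2 ∂P' := by
    intro r
    rw [← integral_finsetSum _ fun k _ => hZ2 (r, k)]
    simp_rw [norm_sq_star_dotProduct_dft]
    rfl
  -- The trace is at most nM rather than 2nM, since the two parts share the unit mass of the
  -- weights.
  have hT : ∑ a, ∫ ω, Z a ω ^ 2 ∂P' ≤ n * M := by
    have hk : ∀ r k, ∫ ω, Z (r, k) ω ^ 2 ∂P' ≤ M * ∑ b : Fin N × Fin p, part θ v k b ^ 2 := by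
      intro r k
      have h1 := hy.integral_sq_le fun d => if d.1 = r then part θ v k d.2 else 0
      have h2 : ∀ ω, Z (r, k) ω = ∑ d : Fin n × Fin N × Fin p,
          (if d.1 = r then part θ v k d.2 else 0) * y d.1 ω d.2.1 d.2.2 := fun ω => by
        rw [Fintype.sum_prod_type, Finset.sum_eq_single r]
        · simp [Z]
        · intro r' _ h; simp [h]
        · simp
      have h3 : ∑ d : Fin n × Fin N × Fin p, (if d.1 = r then part θ v k d.2 else 0) ^ 2
          = ∑ b : Fin N × Fin p, part θ v k b ^ 2 := by
        rw [Fintype.sum_prod_type, Finset.sum_eq_single r]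
        · simp
        · intro r' _ h; simp [h]
        · simp
      simp_rw [h2]
      rwa [h3] at h1
    calc ∑ a, ∫ ω, Z a ω ^ 2 ∂P' ≤ ∑ a : Fin n × Fin 2, M * ∑ b : Fin N × Fin p, part θ v a.2 b ^ 2 :=
          Finset.sum_le_sum fun a _ => hk a.1 a.2
      _ = n * M := by
          rw [Fintype.sum_prod_type]
          have h1 : ∑ k, ∑ b : Fin N × Fin p, part θ v k b ^ 2 = 1 := by
            rw [Finset.sum_comm, Finset.sum_congr rfl fun b _ => sum_part_sq θ v b, hw]
          simp_rw [← Finset.mul_sum, h1]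
          simp [mul_comm]
  -- With K = n and t = nδ/2, the condition t ≤ 6KM reads δ ≤ 12M, and t²/(32KM²) = δ²n/(128M²).
  have hmain := measure_abs_sum_sq_sub_ge_le hZG hZ0 hM hn0 hV hT
    (t := n * δ / 2) (by positivity) (by nlinarith)
  have hset : {ω | δ / 2 ≤ ‖star (v : Fin p → ℂ) ⬝ᵥ
        (psdmEstimator (fun r => y r ω) θ - meanPsdm P x N θ).mulVec v‖}
      = {ω | n * δ / 2 ≤ |∑ a, Z a ω ^ 2 - ∑ a, ∫ ω, Z a ω ^ 2 ∂P'|} := by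
    ext ω
    simp only [Set.mem_ofPred_eq]
    have hmean : star (v : Fin p → ℂ) ⬝ᵥ (meanPsdm P x N θ).mulVec v
        = ((1 / (n : ℝ) * ∑ a, ∫ ω, Z a ω ^ 2 ∂P' : ℝ) : ℂ) := by
      rw [Fintype.sum_prod_type, Finset.sum_congr rfl fun r _ => hr r]
      rw [Complex.ofReal_mul, Complex.ofReal_sum,
        Finset.sum_congr rfl fun r _ => hy.integral_norm_sq θ v r]
      simp [hn]
    rw [Matrix.sub_mulVec, dotProduct_sub, star_dotProduct_psdmEstimator, hmean, ← hsumZ,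
      ← Complex.ofReal_sub, ← mul_sub, Complex.norm_real, Real.norm_eq_abs, abs_mul,
      abs_of_pos (by positivity), one_div, ← div_eq_inv_mul, le_div_iff₀ hn0]
    constructor <;> intro h <;> linarith
  rw [hset]
  refine hmain.trans_eq ?_
  congr 2
  field_simp
  norm_num

end IsGaussianSample

lemma isHermitian_psdmEstimator (z : Fin n → Fin N → Fin p → ℝ) (θ : ℝ) :
    (psdmEstimator z θ).IsHermitian := by
  rw [Matrix.IsHermitian, psdmEstimator, Matrix.conjTranspose_smul, Matrix.conjTranspose_sum]
  simp [Matrix.conjTranspose_vecMulVec]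

lemma isHermitian_meanPsdm (hsym : ∀ k i j, autocorr P x (-k) i j = autocorr P x k j i) (θ : ℝ) :
    (meanPsdm P x N θ).IsHermitian := by
  have h1 : ∀ k, (psdmTerm P x θ k).conjTranspose = psdmTerm P x θ (-k) := fun k => by
    ext i j
    simp only [psdmTerm, Matrix.conjTranspose_apply, Matrix.smul_apply, Matrix.map_apply, hsym,
      smul_eq_mul, star_mul', Complex.star_def, Complex.conj_ofReal, ← Complex.exp_conj]
    congr 2
    simp
  rw [Matrix.IsHermitian, meanPsdm, Matrix.conjTranspose_smul, Matrix.conjTranspose_sum]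
  simp_rw [Matrix.conjTranspose_sum, h1]
  rw [Finset.sum_comm]
  simp

/-- Absorbs the size of the net and the factor 2 of the two-sided tail; for p ≥ 1 the product is at
most 50^p, and 50 < 2⁶ < e⁶. -/
lemma two_mul_pow_le_exp (hp : p ≠ 0) : 2 * (25 : ℝ) ^ p ≤ Real.exp (6 * p) := by
  have h1 : (50 : ℝ) ≤ Real.exp 6 := by
    have h := Real.exp_one_gt_d9
    have : Real.exp 6 = Real.exp 1 ^ 6 := by rw [← Real.exp_nat_mul]; norm_num
    rw [this]
    calc (50 : ℝ) ≤ 2 ^ 6 := by norm_num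
      _ ≤ _ := by gcongr; linarith
  calc 2 * (25 : ℝ) ^ p ≤ 2 ^ p * 25 ^ p := by
        gcongr
        exact le_self_pow₀ (by norm_num) hp
    _ = 50 ^ p := by rw [← mul_pow]; norm_num
    _ ≤ Real.exp 6 ^ p := by gcongr
    _ = _ := by rw [← Real.exp_nat_mul, mul_comm]

end DDAG

theorem corollary4p3 {Ω Ω' : Type*} [MeasurableSpace Ω] [MeasurableSpace Ω']
    (P : Measure Ω) [IsProbabilityMeasure P] (P' : Measure Ω') [IsProbabilityMeasure P']
    {p n N : ℕ} (G : Digraph (Fin p)) (h : Fin p → Fin p → ℤ → ℝ)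
    (e x : ℤ → Ω → Fin p → ℝ) (hx : DDAG.IsLDS P G h e x)
    (M C ρ : ℝ) (hM : DDAG.PSDMBound P x M) (hR : DDAG.AutocorrDecay P x C ρ)
    (y : Fin n → Ω' → Fin N → Fin p → ℝ)
    (hy : DDAG.RestartAndRecord P x P' y ∨ DDAG.ContinuousSampling P x P' y)
    (ε ε₁ ε₂ : ℝ) (hε₁ : 0 < ε₁) (hε₂ : 0 < ε₂) (hε : ε₂ = ε - ε₁) (hε₂M : ε₂ ≤ 12 * M)
    (hN : 2 * C * ρ⁻¹ / ((1 - ρ⁻¹) ^ 2 * ε₁) < (N : ℝ)) :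
    ∀ θ ∈ Set.Icc 0 (2 * Real.pi),
      P'.real {ω' | ε ≤ ‖DDAG.psdm P x θ - DDAG.psdmEstimator (fun r => y r ω') θ‖}
        ≤ Real.exp (-(ε₂ ^ 2 * n / (128 * M ^ 2)) + 6 * p) := by
  intro θ _
  have hy' : DDAG.IsGaussianSample P x M P' y :=
    hy.elim (fun h => h.isGaussianSample hx hM hR) (fun h => h.isGaussianSample hx hM hR)
  rcases eq_or_ne p 0 with rfl | hp
  · have : {ω' | ε ≤ ‖DDAG.psdm P x θ - DDAG.psdmEstimator (fun r => y r ω') θ‖} = ∅ := by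
      ext ω
      simp only [Set.mem_ofPred_eq, Set.mem_empty_iff_false, iff_false, not_le]
      rw [Subsingleton.elim (DDAG.psdm P x θ - DDAG.psdmEstimator (fun r => y r ω) θ) 0, norm_zero]
      linarith
    rw [this, measureReal_empty]
    positivity
  -- Without trajectories the exponent is 6p ≥ 0, so the bound exceeds every probability.
  rcases eq_or_ne n 0 with rfl | hn
  · refine measureReal_le_one.trans (Real.one_le_exp ?_)
    simp
  have hρ : 0 < ρ⁻¹ := inv_pos.2 (by linarith [hR.2.1])
  have hρ1 : 0 < 1 - ρ⁻¹ := sub_pos.2 (inv_lt_one_of_one_lt₀ hR.2.1)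
  have hC := hR.1
  have hNpos : (0 : ℝ) < N := lt_of_le_of_lt (by positivity) hN
  have hN0 : N ≠ 0 := by exact_mod_cast hNpos.ne'
  have hbias : ‖DDAG.psdm P x θ - DDAG.meanPsdm P x N θ‖ < ε₁ := by
    refine (hR.bias θ hN0).2.2.trans_lt ?_
    rw [div_lt_iff₀ (by positivity)] at hN ⊢
    linarith
  obtain ⟨s, hcard, hs1, hs⟩ := DDAG.exists_net p
  -- Removing the bias leaves a fluctuation of norm at least ε - ε₁ = ε₂; passing to the net halves
  -- it.
  have hsub : {ω' | ε ≤ ‖DDAG.psdm P x θ - DDAG.psdmEstimator (fun r => y r ω') θ‖}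
      ⊆ ⋃ v ∈ s, {ω | ε₂ / 2 ≤ ‖star (v : Fin p → ℂ) ⬝ᵥ
        (DDAG.psdmEstimator (fun r => y r ω) θ - DDAG.meanPsdm P x N θ).mulVec v‖} := by
    intro ω hω
    rw [Set.mem_ofPred_eq] at hω
    obtain ⟨v, hv, hle⟩ := DDAG.exists_norm_le_two_mul_quadratic hp
      ((DDAG.isHermitian_psdmEstimator (fun r => y r ω) θ).sub
        (DDAG.isHermitian_meanPsdm (N := N) hx.autocorr_neg θ)) hs1 hs
    simp only [Set.mem_iUnion, Set.mem_ofPred_eq]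
    refine ⟨v, hv, ?_⟩
    have htri := norm_sub_le_norm_sub_add_norm_sub (DDAG.psdm P x θ) (DDAG.meanPsdm P x N θ)
      (DDAG.psdmEstimator (fun r => y r ω) θ)
    rw [norm_sub_rev (DDAG.meanPsdm P x N θ)] at htri
    linarith
  calc _ ≤ _ := measureReal_mono hsub (measure_ne_top _ _)
    _ ≤ _ := measureReal_biUnion_finset_le _ _
    _ ≤ ∑ v ∈ s, 2 * Real.exp (-(ε₂ ^ 2 * n / (128 * M ^ 2))) :=
        Finset.sum_le_sum fun v hv =>
          hy'.measure_quadratic_ge_le hM.1 hn hN0 θ (hs1 v hv) hε₂ hε₂M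
    _ = (s.card : ℝ) * (2 * Real.exp (-(ε₂ ^ 2 * n / (128 * M ^ 2)))) := by
        rw [Finset.sum_const, nsmul_eq_mul]
    _ ≤ 25 ^ p * (2 * Real.exp (-(ε₂ ^ 2 * n / (128 * M ^ 2)))) := by
        gcongr
        exact_mod_cast hcard
    _ = 2 * 25 ^ p * Real.exp (-(ε₂ ^ 2 * n / (128 * M ^ 2))) := by ring
    _ ≤ Real.exp (6 * p) * Real.exp (-(ε₂ ^ 2 * n / (128 * M ^ 2))) := by
        gcongr
        exact DDAG.two_mul_pow_le_exp hp
    _ = _ := by rw [← Real.exp_add, add_comm]
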